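/- Let $(X_k,Y_k)_{k\ge 1}$ be i.i.d. pairs of real random variables with joint density $g(s,t)$. Put $f(s)=\int g(s,t)\,dt$ (the density of $X$), $a(s)=\int t\,g(s,t)\,dt$, $r(s)=\mathbb{E}[Y\mid X=s]=a(s)/f(s)$ and $\mathbb{E}[Y^2\mid X=s]=\int t^2g(s,t)\,dt/f(s)$. Fix $x\in\mathbb{R}$ with $f(x)>0$ such that $f$ and the function $a(\cdot)$ are twice differentiable at $x$. Let $a\in(0,1)$ be a constant, and assume the following. (A1) $K:\mathbb{R}\to\mathbb{R}$ is continuous, bounded and integrable, $\int K(z)\,dz=1$, $\int zK(z)\,dz=0$, and $z^2K(z)$ is integrable. (A2) $(h_n)_{n\ge1}$ is a positive sequence with $\lim_{n\to\infty}n\left(1-h_{n-1}/h_n\right)=-a$. (A3) (i) For every $t$, $s\mapsto g(s,t)$ is twice continuously differentiable. (ii) For $q\in\{0,1,2\}$, $s\mapsto\int t^q g(s,t)\,dt$ is bounded and continuous at $s=x$; for every real $q\in[2,3]$, $s\mapsto\int|t|^q g(s,t)\,dt$ is bounded. (iii) For $q\in\{0,1\}$, $\int|t|^q\left|\frac{\partial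 g}{\partial s}(x,t)\right|dt<\infty$, and $s\mapsto\int t^q\frac{\partial^2 g}{\partial s^2}(s,t)\,dt$ is bounded and continuous at $s=x$. For stepsizes $(\gamma_n),(\beta_n)$ put $a_0(x)=f_0(x)=0$ and, for $n\ge1$, $$a_n(x)=(1-\beta_n)a_{n-1}(x)+\beta_nh_n^{-1}Y_nK\!\left(\tfrac{x-X_n}{h_n}\right),\qquad f_n(x)=(1-\gamma_n)f_{n-1}(x)+\gamma_nh_n^{-1}K\!\left(\tfrac{x-X_n}{h_n}\right),$$ and let $r_n(x)=a_n(x)/f_n(x)$ if $f_n(x)\ne0$ and $r_n(x)=0$ otherwise. With $R(K)=\int K^2(z)\,dz$ and $\mu_2(K)=\int z^2K(z)\,dz$, put $$B^{(2)}_{a,\xi}(x)=\frac{1}{2f(x)}\left(\frac{a^{(2)}(x)}{1-2a\xi}-\frac{1-a}{1-3a}\,r(x)f^{(2)}(x)\right)\mu_2(K),$$ $$V^{(2)}_{a,\xi,\beta}(x)=\left\{\frac{\mathbb{E}[Y^2\mid X=x]}{(2-(\beta-a)\xi)f(x)}-(1-a)\,\xi\,\frac{r^2(x)}{f(x)}\right\}R(K).$$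 Suppose that $nh_n^5\to c$ for some $c\ge0$. (If a denominator in $B^{(2)}$ vanishes, then $a>1/5$, hence $c=0$, and $\sqrt c\,B^{(2)}$ is read as $0$.) 1. If $(\gamma_n,\beta_n)=((1-a)n^{-1},n^{-1})$, then $$\sqrt{nh_n}\,\bigl(r_n(x)-r(x)\bigr)\xrightarrow{\ \mathcal D\ }\mathcal N\!\left(\sqrt c\,B^{(2)}_{a,1}(x),\;V^{(2)}_{a,1,1}(x)\right).$$ 2. If $(\gamma_n,\beta_n)=((1-a)n^{-1},(1-a)n^{-1})$, then $$\sqrt{nh_n}\,\bigl(r_n(x)-r(x)\bigr)\xrightarrow{\ \mathcal D\ }\mathcal N\!\left(\sqrt c\,B^{(2)}_{a,(1-a)^{-1}}(x),\;(1-a)\,V^{(2)}_{a,(1-a)^{-1},1}(x)\right).$$ In both cases the stated variance is nonnegative. -/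

import Mathlib

open MeasureTheory ProbabilityTheory Filter Topology

noncomputable section

namespace SemiRecursive

/-- The Galambos--Seneta class `GS(γ)`: positive sequences `(v_n)_{n ≥ 1}` with
`n (1 - v_{n-1} / v_n) → γ`. The value `v 0` plays no role. -/
def GS (γ : ℝ) (v : ℕ → ℝ) : Prop :=
  (∀ n, 1 ≤ n → 0 < v n) ∧
    Tendsto (fun n : ℕ => (n : ℝ) * (1 - v (n - 1) / v n)) atTop (𝓝 γ)

/-- `u` is twice differentiable at the point `x`. -/
def TwiceDifferentiableAt (u : ℝ → ℝ) (x : ℝ) : Prop :=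
  (∀ᶠ s in 𝓝 x, DifferentiableAt ℝ u s) ∧ DifferentiableAt ℝ (deriv u) x

/-! ### The model: a joint density `g` of `(X, Y)` -/

/-- `s ↦ ∫ t ^ q g(s, t) dt`. -/
def moment (g : ℝ → ℝ → ℝ) (q : ℕ) (s : ℝ) : ℝ := ∫ t, t ^ q * g s t

/-- The density `f` of `X`. -/
def density (g : ℝ → ℝ → ℝ) (s : ℝ) : ℝ := ∫ t, g s t

/-- The conditional moment `E[Y ^ q | X = s]`, computed from the joint density. -/
def condMoment (g : ℝ → ℝ → ℝ) (q : ℕ) (s : ℝ) : ℝ := moment g q s / density g s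

/-- The regression function `r(s) = E[Y | X = s]`. -/
def regression (g : ℝ → ℝ → ℝ) (s : ℝ) : ℝ := condMoment g 1 s

/-- The function `a(s) = E[Y | X = s] f(s)`, that is, `∫ t g(s, t) dt`. -/
def regNumerator (g : ℝ → ℝ → ℝ) (s : ℝ) : ℝ := moment g 1 s

/-- `g` is a joint probability density of the pairs `(X_k, Y_k)`, `k ≥ 1`, which are independent
and identically distributed. -/
structure IsIIDSample {Ω : Type*} [MeasurableSpace Ω] (P : Measure Ω)
    (X Y : ℕ → Ω → ℝ) (g : ℝ → ℝ → ℝ) : Prop where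
  measurable_density : Measurable (Function.uncurry g)
  nonneg : ∀ s t, 0 ≤ g s t
  law : ∀ k, 1 ≤ k → HasLaw (fun ω => (X k ω, Y k ω))
    ((volume : Measure (ℝ × ℝ)).withDensity fun p => ENNReal.ofReal (g p.1 p.2)) P
  indep : iIndepFun (fun (k : ℕ) ω => (X (k + 1) ω, Y (k + 1) ω)) P

/-! ### Assumptions on the kernel and on the density -/

/-- Assumption on the kernel `K`. -/
structure KernelAssumption (K : ℝ → ℝ) : Prop where
  continuous : Continuous K
  bounded : ∃ C, ∀ z, |K z| ≤ C
  integrable : Integrable K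
  integral_eq_one : ∫ z, K z = 1
  integrable_first : Integrable fun z => z * K z
  first_moment : ∫ z, z * K z = 0
  integrable_second : Integrable fun z => z ^ 2 * K z

/-- Assumption on the joint density `g` at the point `x`. -/
structure DensityAssumption (g : ℝ → ℝ → ℝ) (x : ℝ) : Prop where
  contDiff : ∀ t, ContDiff ℝ 2 fun s => g s t
  integrable_moment : ∀ q : ℕ, q ≤ 2 → ∀ s, Integrable fun t => t ^ q * g s t
  bounded_moment : ∀ q : ℕ, q ≤ 2 → ∃ C, ∀ s, |moment g q s| ≤ C
  continuous_moment : ∀ q : ℕ, q ≤ 2 → ContinuousAt (moment g q) x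
  integrable_absMoment : ∀ q : ℝ, 2 ≤ q → q ≤ 3 → ∀ s, Integrable fun t => |t| ^ q * g s t
  bounded_absMoment : ∀ q : ℝ, 2 ≤ q → q ≤ 3 → ∃ C, ∀ s, ∫ t, |t| ^ q * g s t ≤ C
  integrable_deriv : ∀ q : ℕ, q ≤ 1 → Integrable fun t => |t| ^ q * |deriv (fun s => g s t) x|
  integrable_deriv2 : ∀ q : ℕ, q ≤ 1 → ∀ s,
    Integrable fun t => t ^ q * iteratedDeriv 2 (fun u => g u t) s
  bounded_deriv2 : ∀ q : ℕ, q ≤ 1 → ∃ C, ∀ s,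
    |∫ t, t ^ q * iteratedDeriv 2 (fun u => g u t) s| ≤ C
  continuous_deriv2 : ∀ q : ℕ, q ≤ 1 →
    ContinuousAt (fun s => ∫ t, t ^ q * iteratedDeriv 2 (fun u => g u t) s) x

/-! ### The estimators -/

/-- The recursion `u_0 = 0`, `u_n = (1 - s_n) u_{n-1} + s_n w_n` with stepsizes `s_n` and
observations `w_n`. -/
def recursion (step w : ℕ → ℝ) : ℕ → ℝ
  | 0 => 0
  | n + 1 => (1 - step (n + 1)) * recursion step w n + step (n + 1) * w (n + 1)

/-- The estimator `a_n(x)`. -/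
def aEst {Ω : Type*} (β h : ℕ → ℝ) (K : ℝ → ℝ) (X Y : ℕ → Ω → ℝ) (x : ℝ) (n : ℕ) (ω : Ω) : ℝ :=
  recursion β (fun k => (h k)⁻¹ * Y k ω * K ((x - X k ω) / h k)) n

/-- The density estimator `f_n(x)`. -/
def fEst {Ω : Type*} (γ h : ℕ → ℝ) (K : ℝ → ℝ) (X : ℕ → Ω → ℝ) (x : ℝ) (n : ℕ) (ω : Ω) : ℝ :=
  recursion γ (fun k => (h k)⁻¹ * K ((x - X k ω) / h k)) n

/-- The semi-recursive regression estimator `r_n(x)`. -/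
def rEst {Ω : Type*} (γ β h : ℕ → ℝ) (K : ℝ → ℝ) (X Y : ℕ → Ω → ℝ) (x : ℝ) (n : ℕ) (ω : Ω) : ℝ :=
  if fEst γ h K X x n ω ≠ 0 then aEst β h K X Y x n ω / fEst γ h K X x n ω else 0

/-! ### The limiting constants -/

/-- `R(K) = ∫ K²`. -/
def kernelR (K : ℝ → ℝ) : ℝ := ∫ z, K z ^ 2

/-- `μ_j(K) = ∫ z ^ j K(z) dz`. -/
def kernelMoment (j : ℕ) (K : ℝ → ℝ) : ℝ := ∫ z, z ^ j * K z

/-- The bias constant `B⁽²⁾_{a,ξ}(x)`. -/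
def biasConst (K : ℝ → ℝ) (g : ℝ → ℝ → ℝ) (x a ξ : ℝ) : ℝ :=
  1 / (2 * density g x) *
    (iteratedDeriv 2 (regNumerator g) x / (1 - 2 * a * ξ)
      - (1 - a) / (1 - 3 * a) * regression g x * iteratedDeriv 2 (density g) x) *
    kernelMoment 2 K

/-- The variance constant `V⁽²⁾_{a,ξ,β}(x)`. -/
def varConst (K : ℝ → ℝ) (g : ℝ → ℝ → ℝ) (x a ξ β : ℝ) : ℝ :=
  (condMoment g 2 x / ((2 - (β - a) * ξ) * density g x)
      - (1 - a) * ξ * (regression g x ^ 2 / density g x)) *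
    kernelR K

/-- Convergence in distribution of real random variables on `(Ω, P)` to the Gaussian law with mean
`m` and variance `v ≥ 0`. -/
def TendstoGaussian {Ω : Type*} [MeasurableSpace Ω] (P : Measure Ω) [IsProbabilityMeasure P]
    (U : ℕ → Ω → ℝ) (m v : ℝ) : Prop :=
  0 ≤ v ∧ TendstoInDistribution U atTop (id : ℝ → ℝ) (fun _ => P) (gaussianReal m v.toNNReal)

end SemiRecursive

end

/-! Where f_n ≠ 0, r_n(x) - r = (a_n - r f_n) / f_n with r = r(x). As f_n → f(x) in probability,
Slutsky's theorem (`tendstoInDistribution_ratio`) leaves the linear statistic a_n - r f_n. Both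
recursions have stepsizes s/n, so this statistic is a weighted sum of independent kernel
observations, and it splits into a deterministic mean and a centred part.

One fact drives all the limits (`tendsto_of_recursion`): if T_n = ρ_n T_{n-1} + e_n/n with n(ρ_n -
1) → -d < 0 and e_n → e₀, then T_n → e₀/d. Since n h_n / ((n-1) h_{n-1}) has rate 1 - a, multiplying
a recursion by a power of n h_n only shifts its rate. Variances and covariances, scaled by n h_n,
thus acquire denominators s₁ + s₂ - (1 - a); biases, scaled by √(n h_n), acquire s - (1 - a)/2;
third absolute moments are O((n h_n)^(-1/2)).

The centred part is therefore asymptotically normal by Lyapunov's theorem, proved here with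
characteristic functions (`tendstoInDistribution_of_lyapunov`). The mean part comes from the
second-order expansion of kernel smoothing (`KernelAssumption.tendsto_bias`) and √(n h_n^5) → √c.
The resulting bias constants agree with the stated ones because c > 0 forces a = 1/5
(`eq_one_fifth`). -/

namespace SemiRecursive

/-! ### Asymptotics of first-order linear recursions -/

/-- The ratios `ρ n` satisfy `n (ρ n - 1) → μ`. -/
def RatioRate (ρ : ℕ → ℝ) (μ : ℝ) : Prop :=
  Tendsto (fun n : ℕ => (n : ℝ) * (ρ n - 1)) atTop (𝓝 μ)

/-! ### Calculus of ratio rates: they behave like logarithmic derivatives. -/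

namespace RatioRate

variable {ρ σ : ℕ → ℝ} {μ ν : ℝ}

theorem congr (h : RatioRate ρ μ) (hρ : ∀ᶠ n in atTop, ρ n = σ n) : RatioRate σ μ :=
  Tendsto.congr' (hρ.mono fun n hn => by simp only [hn]) h

theorem tendsto_one (h : RatioRate ρ μ) : Tendsto ρ atTop (𝓝 1) := by
  have h1 : Tendsto (fun n : ℕ => (n : ℝ)⁻¹ * ((n : ℝ) * (ρ n - 1)) + 1) atTop (𝓝 (0 * μ + 1)) :=
    (tendsto_natCast_atTop_atTop.inv_tendsto_atTop.mul h).add_const 1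
  simp only [zero_mul, zero_add] at h1
  refine h1.congr' ?_
  filter_upwards [eventually_gt_atTop 0] with n hn
  have : (n : ℝ) ≠ 0 := by positivity
  field_simp
  ring

/-- From ρσ - 1 = (ρ - 1)σ + (σ - 1) and σ → 1. -/
theorem mul (h : RatioRate ρ μ) (h' : RatioRate σ ν) :
    RatioRate (fun n => ρ n * σ n) (μ + ν) := by
  have := (Tendsto.mul h h'.tendsto_one).add h'
  rw [mul_one] at this
  exact this.congr fun n => by ring

theorem inv (h : RatioRate ρ μ) : RatioRate (fun n => (ρ n)⁻¹) (-μ) := by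
  have := (Tendsto.mul h (h.tendsto_one.inv₀ one_ne_zero)).neg
  rw [inv_one, mul_one] at this
  refine this.congr' ?_
  filter_upwards [h.tendsto_one.eventually_ne one_ne_zero] with n hn
  field_simp
  ring

theorem sqrt (h : RatioRate ρ μ) : RatioRate (fun n => √(ρ n)) (μ / 2) := by
  have h1 : Tendsto (fun n => √(ρ n) + 1) atTop (𝓝 2) := by
    have := (h.tendsto_one.sqrt).add_const 1
    rwa [Real.sqrt_one, one_add_one_eq_two] at this
  have := Tendsto.div h h1 two_ne_zero
  refine this.congr' ?_
  filter_upwards [h.tendsto_one.eventually (lt_mem_nhds zero_lt_one)] with n hn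
  have h2 : 0 < √(ρ n) + 1 := by positivity
  have h3 : ρ n - 1 = (√(ρ n) - 1) * (√(ρ n) + 1) := by
    linear_combination -(Real.sq_sqrt hn.le)
  simp only [Pi.div_apply, h3]
  field_simp

theorem pow (h : RatioRate ρ μ) (j : ℕ) : RatioRate (fun n => ρ n ^ j) (j * μ) := by
  induction j with
  | zero => simp [RatioRate]
  | succ j ih =>
    have := ih.mul h
    simp only [← pow_succ] at this
    convert this using 1
    push_cast
    ring

theorem one_sub_div (s : ℝ) : RatioRate (fun n => 1 - s / (n : ℝ)) (-s) := by
  refine tendsto_const_nhds.congr' ?_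
  filter_upwards [eventually_gt_atTop 0] with n hn
  have : (n : ℝ) ≠ 0 := by positivity
  field_simp
  ring

theorem natCast : RatioRate (fun n => (n : ℝ) / ((n - 1 : ℕ) : ℝ)) 1 := by
  have := (one_sub_div 1).inv
  rw [neg_neg] at this
  refine this.congr ?_
  filter_upwards [eventually_gt_atTop 1] with n hn
  have h1 : (1 : ℝ) < n := by exact_mod_cast hn
  have h2 : (n : ℝ) - 1 ≠ 0 := by linarith
  rw [Nat.cast_pred (by omega)]
  field_simp

end RatioRate

/-- A sequence contracted by the factors `1 - δ / (n + 1)` becomes eventually nonpositive up to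
any error. -/
theorem eventually_le_of_contraction {u : ℕ → ℝ} {δ ε : ℝ} (hδ : 0 < δ) (hε : 0 < ε)
    (hu : ∀ᶠ n : ℕ in atTop, u (n + 1) ≤ (1 - δ / ((n + 1 : ℕ) : ℝ)) * u n) :
    ∀ᶠ n in atTop, u n ≤ ε := by
  obtain ⟨N₀, hN₀⟩ := eventually_atTop.1 hu
  obtain ⟨N₁, hN₁⟩ := exists_nat_ge δ
  set N := max N₀ N₁
  set H : ℕ → ℝ := fun n => ∑ k ∈ Finset.range n, 1 / ((k : ℝ) + 1) with hH
  -- Beyond `N ≥ δ` the contraction factors are nonnegative and at most exp(-δ/(n+1)), so they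
  -- multiply to an exponential of the divergent harmonic sum.
  have key : ∀ n, N ≤ n → u n ≤ |u N| * Real.exp (-δ * (H n - H N)) := by
    intro n hn
    induction n, hn using Nat.le_induction with
    | base => simpa using le_abs_self (u N)
    | succ n hn ih =>
      have hpos : (0 : ℝ) < n + 1 := by positivity
      have h0 : 0 ≤ 1 - δ / ((n + 1 : ℕ) : ℝ) := by
        have : (N₁ : ℝ) ≤ n := by exact_mod_cast (le_max_right _ _).trans hn
        rw [sub_nonneg, div_le_one (by positivity)]
        push_cast
        linarith
      have h1 : 1 - δ / ((n + 1 : ℕ) : ℝ) ≤ Real.exp (-(δ / ((n + 1 : ℕ) : ℝ))) :=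
        Real.one_sub_le_exp_neg _
      calc u (n + 1) ≤ (1 - δ / ((n + 1 : ℕ) : ℝ)) * u n := hN₀ n ((le_max_left _ _).trans hn)
        _ ≤ (1 - δ / ((n + 1 : ℕ) : ℝ)) * (|u N| * Real.exp (-δ * (H n - H N))) := by gcongr
        _ ≤ Real.exp (-(δ / ((n + 1 : ℕ) : ℝ))) * (|u N| * Real.exp (-δ * (H n - H N))) := by
          gcongr
        _ = |u N| * Real.exp (-δ * (H (n + 1) - H N)) := by
          rw [mul_left_comm, ← Real.exp_add]
          congr 2
          simp only [hH, Finset.sum_range_succ]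
          push_cast
          ring
  have hlim : Tendsto (fun n => |u N| * Real.exp (-δ * (H n - H N))) atTop (𝓝 0) := by
    rw [← mul_zero |u N|]
    refine (Real.tendsto_exp_atBot.comp ?_).const_mul _
    refine Tendsto.const_mul_atTop_of_neg (by linarith) ?_
    exact tendsto_atTop_add_const_right _ _ Real.tendsto_sum_range_one_div_nat_succ_atTop
  filter_upwards [eventually_ge_atTop N, hlim.eventually (ge_mem_nhds hε)] with n h1 h2
  exact (key n h1).trans h2

/-- If `T (n + 1) = ρ (n + 1) T n + e (n + 1) / (n + 1)` with `n (ρ n - 1) → -d < 0` and `e n → e₀`,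
then `T n → e₀ / d`. -/
theorem tendsto_of_recursion {ρ T e : ℕ → ℝ} {d e₀ : ℝ} (hd : 0 < d) (hρ : RatioRate ρ (-d))
    (he : Tendsto e atTop (𝓝 e₀))
    (hT : ∀ᶠ n : ℕ in atTop, T (n + 1) = ρ (n + 1) * T n + e (n + 1) / ((n + 1 : ℕ) : ℝ)) :
    Tendsto T atTop (𝓝 (e₀ / d)) := by
  set V : ℕ → ℝ := fun n => T n - e₀ / d with hV
  set e' : ℕ → ℝ := fun n => e n - e₀ + e₀ / d * (n * (ρ n - 1) + d) with he'
  have he'0 : Tendsto e' atTop (𝓝 0) := by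
    have := (he.sub_const e₀).add ((hρ.add_const d).const_mul (e₀ / d))
    simpa using this
  have hrec : ∀ᶠ n : ℕ in atTop,
      V (n + 1) = ρ (n + 1) * V n + e' (n + 1) / ((n + 1 : ℕ) : ℝ) := by
    filter_upwards [hT] with n hn
    have : ((n + 1 : ℕ) : ℝ) ≠ 0 := by positivity
    simp only [hV, he', hn]
    field_simp
    ring
  rw [Metric.tendsto_nhds]
  intro ε hε
  have hδ : 0 < d / 2 := by positivity
  -- Half of the rate d suffices for the contraction. An error below (d/2)(ε/4) is exactly what
  -- subtracting ε/4 from |V| absorbs.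
  have hcontr : ∀ᶠ n : ℕ in atTop,
      |V (n + 1)| - ε / 4 ≤ (1 - d / 2 / ((n + 1 : ℕ) : ℝ)) * (|V n| - ε / 4) := by
    have hs := tendsto_add_atTop_nat 1
    have e1 := hs.eventually (hρ.tendsto_one.eventually (lt_mem_nhds zero_lt_one))
    have e2 := hs.eventually (Tendsto.eventually hρ (gt_mem_nhds (show -d < -(d / 2) by linarith)))
    have e3 := hs.eventually (he'0.abs.eventually
      (gt_mem_nhds (show |(0 : ℝ)| < d / 2 * (ε / 4) by simp; positivity)))
    filter_upwards [hrec, e1, e2, e3] with n hn h1 h2 h3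
    have hpos : (0 : ℝ) < ((n + 1 : ℕ) : ℝ) := by positivity
    have h4 : ρ (n + 1) ≤ 1 - d / 2 / ((n + 1 : ℕ) : ℝ) := by
      have : ρ (n + 1) - 1 ≤ -(d / 2) / ((n + 1 : ℕ) : ℝ) := by
        rw [le_div_iff₀ hpos]
        linarith
      rw [neg_div] at this
      linarith
    have h5 : |V (n + 1)| ≤ ρ (n + 1) * |V n| + |e' (n + 1)| / ((n + 1 : ℕ) : ℝ) := by
      rw [hn]
      refine (abs_add_le _ _).trans_eq ?_
      rw [abs_mul, abs_div, abs_of_pos h1, abs_of_pos hpos]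
    have h6 : |e' (n + 1)| / ((n + 1 : ℕ) : ℝ) ≤ d / 2 / ((n + 1 : ℕ) : ℝ) * (ε / 4) := by
      rw [div_mul_eq_mul_div]
      gcongr
    have h7 := mul_le_mul_of_nonneg_right h4 (abs_nonneg (V n))
    linarith
  filter_upwards [eventually_le_of_contraction (u := fun n => |V n| - ε / 4) hδ
    (show 0 < ε / 4 by positivity) hcontr] with n hn
  rw [Real.dist_eq]
  change |V n| < ε
  linarith

/-- Normalised form of `tendsto_of_recursion`. -/
theorem tendsto_mul_of_recursion {m θ S δ : ℕ → ℝ} {μ σ e : ℝ} (hm : ∀ n, 1 ≤ n → 0 < m n)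
    (hmr : RatioRate (fun n => m n / m (n - 1)) μ) (hθ : RatioRate θ (-σ)) (hσ : μ < σ)
    (hδ : Tendsto (fun n : ℕ => n * (m n * δ n)) atTop (𝓝 e))
    (hS : ∀ n : ℕ, S (n + 1) = θ (n + 1) * S n + δ (n + 1)) :
    Tendsto (fun n => m n * S n) atTop (𝓝 (e / (σ - μ))) := by
  -- The product m S obeys a recursion with factors θ_n m_n / m_{n-1}, of rate μ - σ < 0, and errors
  -- n m_n δ_n. The initial value of S is forgotten.
  refine tendsto_of_recursion (ρ := fun n => θ n * (m n / m (n - 1))) (sub_pos.2 hσ) ?_ hδ ?_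
  · convert hθ.mul hmr using 1
    ring
  · filter_upwards [eventually_ge_atTop 1] with n hn
    have h1 := hm n hn
    have h2 : ((n + 1 : ℕ) : ℝ) ≠ 0 := by positivity
    rw [hS n, Nat.add_sub_cancel]
    field_simp

/-- A positive sequence whose ratios have positive rate tends to infinity. -/
theorem tendsto_inv_of_ratioRate {m : ℕ → ℝ} {μ : ℝ} (hm : ∀ n, 1 ≤ n → 0 < m n)
    (hmr : RatioRate (fun n => m n / m (n - 1)) μ) (hμ : 0 < μ) :
    Tendsto (fun n => (m n)⁻¹) atTop (𝓝 0) := by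
  -- The inverses satisfy a recursion of rate -μ without error term.
  have := tendsto_of_recursion (T := fun n => (m n)⁻¹) (e := fun _ => 0) hμ hmr.inv
    tendsto_const_nhds ?_
  · simpa using this
  · filter_upwards [eventually_ge_atTop 1] with n hn
    have h1 := hm n hn
    have h2 := hm (n + 1) (by omega)
    rw [Nat.add_sub_cancel]
    field_simp
    ring

/-! ### The class `GS` -/

theorem GS.ratioRate {v : ℕ → ℝ} {γ : ℝ} (h : GS γ v) : RatioRate (fun n => v n / v (n - 1)) γ := by
  have h1 : RatioRate (fun n => v (n - 1) / v n) (-γ) := by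
    refine h.2.neg.congr fun n => by ring
  have := h1.inv
  rw [neg_neg] at this
  exact this.congr (Eventually.of_forall fun n => by rw [inv_div])

section Bandwidth

variable {h : ℕ → ℝ} {a : ℝ} (hh : GS (-a) h)
include hh

theorem natCast_mul_pos : ∀ n : ℕ, 1 ≤ n → 0 < (n : ℝ) * h n := fun n hn => by
  have := hh.1 n hn
  positivity

theorem ratioRate_natCast_mul :
    RatioRate (fun n : ℕ => ((n : ℝ) * h n) / (((n - 1 : ℕ) : ℝ) * h (n - 1))) (1 - a) := by
  have := RatioRate.natCast.mul hh.ratioRate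
  exact this.congr (Eventually.of_forall fun n => by rw [div_mul_div_comm])

theorem ratioRate_sqrt :
    RatioRate (fun n : ℕ => √((n : ℝ) * h n) / √(((n - 1 : ℕ) : ℝ) * h (n - 1)))
      ((1 - a) / 2) := by
  refine (ratioRate_natCast_mul hh).sqrt.congr ?_
  filter_upwards [eventually_ge_atTop 2] with n hn
  exact Real.sqrt_div' _ (natCast_mul_pos hh (n - 1) (by omega)).le

theorem ratioRate_sq :
    RatioRate (fun n : ℕ => ((n : ℝ) * h n) ^ 2 / (((n - 1 : ℕ) : ℝ) * h (n - 1)) ^ 2)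
      (2 * (1 - a)) := by
  have := (ratioRate_natCast_mul hh).pow 2
  push_cast at this
  exact this.congr (Eventually.of_forall fun n => by rw [div_pow])

theorem tendsto_bandwidth (c : ℝ) (hnc : Tendsto (fun n : ℕ => (n : ℝ) * h n ^ 5) atTop (𝓝 c)) :
    Tendsto h atTop (𝓝 0) := by
  have h5 : Tendsto (fun n => h n ^ 5) atTop (𝓝 0) := by
    have := tendsto_natCast_atTop_atTop.inv_tendsto_atTop.mul hnc
    rw [zero_mul] at this
    refine this.congr' ?_
    filter_upwards [eventually_gt_atTop 0] with n hn
    have : (n : ℝ) ≠ 0 := by positivity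
    simp only [Pi.inv_apply]
    field_simp
  rw [Metric.tendsto_nhds]
  intro ε hε
  filter_upwards [h5.eventually (gt_mem_nhds (show 0 < ε ^ 5 by positivity)),
    eventually_ge_atTop 1] with n h1 h2
  have h3 := hh.1 n h2
  rw [Real.dist_eq, sub_zero, abs_of_pos h3]
  exact lt_of_pow_lt_pow_left₀ 5 hε.le h1

/-- If `n h_n ^ 5` has a nonzero limit then `h` decays like `n ^ (-1 / 5)`. -/
theorem eq_one_fifth {c : ℝ} (hc : 0 < c)
    (hnc : Tendsto (fun n : ℕ => (n : ℝ) * h n ^ 5) atTop (𝓝 c)) : a = 1 / 5 := by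
  have hpos : ∀ n : ℕ, 1 ≤ n → 0 < (n : ℝ) * h n ^ 5 := fun n hn => by
    have := hh.1 n hn
    positivity
  have hr : RatioRate (fun n : ℕ => ((n : ℝ) * h n ^ 5) / (((n - 1 : ℕ) : ℝ) * h (n - 1) ^ 5))
      (1 - 5 * a) := by
    have := RatioRate.natCast.mul (hh.ratioRate.pow 5)
    push_cast at this
    rw [mul_neg, ← sub_eq_add_neg] at this
    exact this.congr (Eventually.of_forall fun n => by rw [div_pow, div_mul_div_comm])
  -- The sequence n h_n^5 has rate 1 - 5a. A negative rate would send it to 0 and a positive one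
  -- would send its inverse to 0; a limit in (0, ∞) excludes both.
  rcases lt_trichotomy (1 - 5 * a) 0 with h0 | h0 | h0
  · have hr' : RatioRate (fun n : ℕ => ((n : ℝ) * h n ^ 5)⁻¹ /
        (((n - 1 : ℕ) : ℝ) * h (n - 1) ^ 5)⁻¹) (-(1 - 5 * a)) :=
      hr.inv.congr (Eventually.of_forall fun n => by rw [inv_div, inv_div_inv])
    have := tendsto_inv_of_ratioRate (fun n hn => inv_pos.2 (hpos n hn)) hr' (by linarith)
    simp only [inv_inv] at this
    exact absurd (tendsto_nhds_unique this hnc) hc.ne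
  · linarith
  · have := tendsto_inv_of_ratioRate hpos hr h0
    exact absurd (tendsto_nhds_unique this (hnc.inv₀ hc.ne')) (inv_pos.2 hc).ne

end Bandwidth

/-! ### Weights of the recursion with stepsizes `s / n` -/

/-- The weight of the `k`-th observation in the `n`-th step of the recursion with stepsizes
`s / n`. -/
noncomputable def weight (s : ℝ) (k n : ℕ) : ℝ :=
  s / (k : ℝ) * ∏ j ∈ Finset.Ioc k n, (1 - s / (j : ℝ))

theorem weight_self (s : ℝ) (n : ℕ) : weight s n n = s / (n : ℝ) := by simp [weight]

theorem weight_succ (s : ℝ) {k n : ℕ} (hk : k ≤ n) :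
    weight s k (n + 1) = (1 - s / ((n + 1 : ℕ) : ℝ)) * weight s k n := by
  rw [weight, weight, Finset.prod_Ioc_succ_top (by omega)]
  ring

theorem weight_nonneg {s : ℝ} (hs0 : 0 ≤ s) (hs1 : s ≤ 1) (k n : ℕ) : 0 ≤ weight s k n := by
  refine mul_nonneg (by positivity) (Finset.prod_nonneg fun j hj => ?_)
  have h1 : (1 : ℝ) ≤ j := by
    have := (Finset.mem_Ioc.1 hj).1
    exact_mod_cast (by omega : 1 ≤ j)
  rw [sub_nonneg, div_le_one (by linarith)]
  linarith

/-- Unrolling leaves no initial term because the recursion starts at 0. The index is shifted since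
observations are numbered from 1. -/
theorem recursion_eq_sum (s : ℝ) (w : ℕ → ℝ) (n : ℕ) :
    recursion (fun k => s / (k : ℝ)) w n
      = ∑ k ∈ Finset.range n, weight s (k + 1) n * w (k + 1) := by
  induction n with
  | zero => rfl
  | succ n ih =>
    rw [recursion, ih, Finset.sum_range_succ, weight_self, Finset.mul_sum]
    congr 1
    refine Finset.sum_congr rfl fun k hk => ?_
    rw [weight_succ s (by have := Finset.mem_range.1 hk; omega)]
    ring

theorem sum_weight_mul_weight_succ (s₁ s₂ : ℝ) (q : ℕ → ℝ) (n : ℕ) :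
    ∑ k ∈ Finset.range (n + 1), weight s₁ (k + 1) (n + 1) * weight s₂ (k + 1) (n + 1) * q (k + 1)
      = ((1 - s₁ / ((n + 1 : ℕ) : ℝ)) * (1 - s₂ / ((n + 1 : ℕ) : ℝ))) *
          ∑ k ∈ Finset.range n, weight s₁ (k + 1) n * weight s₂ (k + 1) n * q (k + 1)
        + s₁ / ((n + 1 : ℕ) : ℝ) * (s₂ / ((n + 1 : ℕ) : ℝ)) * q (n + 1) := by
  rw [Finset.sum_range_succ, weight_self, weight_self, Finset.mul_sum]
  congr 1
  refine Finset.sum_congr rfl fun k hk => ?_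
  have : k + 1 ≤ n := by have := Finset.mem_range.1 hk; omega
  rw [weight_succ s₁ this, weight_succ s₂ this]
  ring

theorem sum_weight_pow_succ (s : ℝ) (q : ℕ → ℝ) (n : ℕ) :
    ∑ k ∈ Finset.range (n + 1), weight s (k + 1) (n + 1) ^ 3 * q (k + 1)
      = (1 - s / ((n + 1 : ℕ) : ℝ)) ^ 3 *
          ∑ k ∈ Finset.range n, weight s (k + 1) n ^ 3 * q (k + 1)
        + (s / ((n + 1 : ℕ) : ℝ)) ^ 3 * q (n + 1) := by
  rw [Finset.sum_range_succ, weight_self, Finset.mul_sum]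
  congr 1
  refine Finset.sum_congr rfl fun k hk => ?_
  rw [weight_succ s (by have := Finset.mem_range.1 hk; omega)]
  ring

/-! ### Limits of normalised weighted sums. -/

section WeightedSums

variable {h : ℕ → ℝ} {a : ℝ} (hh : GS (-a) h)
include hh

/-- The normalised weighted sums which govern variances. -/
theorem tendsto_sum_weight_mul_weight {s₁ s₂ v : ℝ} {q : ℕ → ℝ} (hs : 1 - a < s₁ + s₂)
    (hq : Tendsto (fun n => h n * q n) atTop (𝓝 v)) :
    Tendsto (fun n : ℕ => (n * h n) *
        ∑ k ∈ Finset.range n, weight s₁ (k + 1) n * weight s₂ (k + 1) n * q (k + 1))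
      atTop (𝓝 (s₁ * s₂ * v / (s₁ + s₂ - (1 - a)))) := by
  -- The factors have rate -(s₁ + s₂), the normalisation n h_n has rate 1 - a, and n (n h_n) times
  -- the innovation is s₁ s₂ h_n q_n.
  refine tendsto_mul_of_recursion (δ := fun n => s₁ / (n : ℝ) * (s₂ / (n : ℝ)) * q n)
    (θ := fun n => (1 - s₁ / (n : ℝ)) * (1 - s₂ / (n : ℝ)))
    (natCast_mul_pos hh) (ratioRate_natCast_mul hh) ?_ hs ?_ (sum_weight_mul_weight_succ s₁ s₂ q)
  · rw [neg_add]
    exact (RatioRate.one_sub_div s₁).mul (RatioRate.one_sub_div s₂)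
  · refine (hq.const_mul (s₁ * s₂)).congr' ?_
    filter_upwards [eventually_gt_atTop 0] with n hn
    have : (n : ℝ) ≠ 0 := by positivity
    field_simp

/-- The normalised weighted sums which govern third moments. -/
theorem tendsto_sum_weight_pow {s : ℝ} (ha : a < 1) (hs : 1 - a ≤ s) :
    Tendsto (fun n : ℕ => √(n * h n) ^ 3 *
        ∑ k ∈ Finset.range n, weight s (k + 1) n ^ 3 * (h (k + 1) ^ 2)⁻¹)
      atTop (𝓝 0) := by
  -- The sum is exactly of order (n h_n)^(-2), so scaling by the power 3/2 leaves a factor (n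
  -- h_n)^(-1/2) → 0.
  have h1 : Tendsto (fun n : ℕ => ((n : ℝ) * h n) ^ 2 *
        ∑ k ∈ Finset.range n, weight s (k + 1) n ^ 3 * (h (k + 1) ^ 2)⁻¹)
      atTop (𝓝 (s ^ 3 / (3 * s - 2 * (1 - a)))) := by
    refine tendsto_mul_of_recursion (δ := fun n => (s / (n : ℝ)) ^ 3 * (h n ^ 2)⁻¹)
      (θ := fun n => (1 - s / (n : ℝ)) ^ 3) (fun n hn => pow_pos (natCast_mul_pos hh n hn) 2)
      (ratioRate_sq hh) ?_ (by linarith) ?_ (sum_weight_pow_succ s fun k => (h k ^ 2)⁻¹)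
    · convert (RatioRate.one_sub_div s).pow 3 using 1
      push_cast
      ring
    · refine tendsto_const_nhds.congr' ?_
      filter_upwards [eventually_gt_atTop 0] with n hn
      have : (n : ℝ) ≠ 0 := by positivity
      have := (hh.1 n hn).ne'
      field_simp
  have h2 := tendsto_inv_of_ratioRate (fun n hn => Real.sqrt_pos.2 (natCast_mul_pos hh n hn))
    (ratioRate_sqrt hh) (by linarith)
  have h3 := h2.mul h1
  rw [zero_mul] at h3
  refine h3.congr' ?_
  filter_upwards [eventually_gt_atTop 0] with n hn
  have h4 := natCast_mul_pos hh n hn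
  have h5 := Real.sqrt_pos.2 h4
  rw [← mul_assoc]
  congr 1
  nth_rewrite 2 [← Real.sq_sqrt h4.le]
  field_simp

/-- The normalised error of the recursion applied to a deterministic sequence. -/
theorem tendsto_recursion_sub {s l : ℝ} {w : ℕ → ℝ} {w₀ : ℝ} (ha : a < 1) (hs : 1 - a ≤ s)
    (hw : Tendsto (fun n : ℕ => √(n * h n) * (w n - w₀)) atTop (𝓝 l)) :
    Tendsto (fun n : ℕ => √(n * h n) * (recursion (fun k => s / (k : ℝ)) w n - w₀))
      atTop (𝓝 (s * l / (s - (1 - a) / 2))) := by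
  refine tendsto_mul_of_recursion (δ := fun n => s / (n : ℝ) * (w n - w₀))
    (θ := fun n => 1 - s / (n : ℝ)) (fun n hn => Real.sqrt_pos.2 (natCast_mul_pos hh n hn))
    (ratioRate_sqrt hh) (RatioRate.one_sub_div s) (by linarith) ?_ fun n => ?_
  · refine (hw.const_mul s).congr' ?_
    filter_upwards [eventually_gt_atTop 0] with n hn
    have : (n : ℝ) ≠ 0 := by positivity
    field_simp
  · rw [recursion]
    ring

end WeightedSums

/-! ### Lyapunov's central limit theorem for triangular arrays -/

/-- Taylor's bound covers |y| ≤ 1. For |y| ≥ 1 every term is dominated by |y|³, with total 1 + 1 + 1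
+ 1/2 ≤ 4. -/
theorem norm_exp_mul_I_sub_le (y : ℝ) :
    ‖Complex.exp (y * Complex.I) - (1 + y * Complex.I - (y : ℂ) ^ 2 / 2)‖ ≤ 4 * |y| ^ 3 := by
  rcases le_total |y| 1 with hy | hy
  · have hx : ‖(y : ℂ) * Complex.I‖ = |y| := by simp
    have := Complex.exp_bound (x := (y : ℂ) * Complex.I) (hx.trans_le hy) (n := 3) (by norm_num)
    rw [hx] at this
    have h2 : ∑ m ∈ Finset.range 3, ((y : ℂ) * Complex.I) ^ m / (m.factorial : ℂ)
        = 1 + y * Complex.I - (y : ℂ) ^ 2 / 2 := by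
      simp only [Finset.sum_range_succ, Finset.sum_range_zero, mul_pow, Complex.I_sq]
      simp [Nat.factorial]
      ring
    rw [h2] at this
    refine this.trans ?_
    have h3 : 0 ≤ |y| ^ 3 := by positivity
    norm_num [Nat.factorial]
    linarith
  · have h1 : ‖Complex.exp (y * Complex.I)‖ = 1 := Complex.norm_exp_ofReal_mul_I y
    have h2 : ‖(1 : ℂ) + y * Complex.I - (y : ℂ) ^ 2 / 2‖ ≤ 1 + |y| + |y| ^ 2 / 2 := by
      refine (norm_sub_le _ _).trans (add_le_add ((norm_add_le _ _).trans_eq ?_) (le_of_eq ?_))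
      · simp
      · simp
    refine (norm_sub_le _ _).trans ?_
    rw [h1]
    have h3 : |y| ≤ |y| ^ 3 := le_self_pow₀ hy (by norm_num)
    have h4 : |y| ^ 2 ≤ |y| ^ 3 := pow_le_pow_right₀ hy (by norm_num)
    have h5 : 1 ≤ |y| ^ 3 := one_le_pow₀ hy
    linarith

theorem abs_exp_neg_sub_le {y : ℝ} (hy : 0 ≤ y) : |Real.exp (-y) - (1 - y)| ≤ y ^ 2 := by
  have h0 : 1 - y ≤ Real.exp (-y) := Real.one_sub_le_exp_neg y
  rw [abs_of_nonneg (by linarith)]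
  rcases le_total y 1 with h1 | h1
  · have := Real.norm_exp_sub_one_sub_id_le (x := -y) (by simpa [abs_of_nonneg hy] using h1)
    rw [Real.norm_eq_abs, norm_neg, Real.norm_eq_abs, sq_abs] at this
    have := (abs_le.1 this).2
    linarith
  · have : Real.exp (-y) ≤ 1 := Real.exp_le_one_iff.2 (by linarith)
    nlinarith

/-- Replace the factors one at a time; the remaining ones have norm at most 1. -/
theorem norm_prod_sub_prod_le {ι : Type*} (s : Finset ι) (f g : ι → ℂ)
    (hf : ∀ i ∈ s, ‖f i‖ ≤ 1) (hg : ∀ i ∈ s, ‖g i‖ ≤ 1) :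
    ‖∏ i ∈ s, f i - ∏ i ∈ s, g i‖ ≤ ∑ i ∈ s, ‖f i - g i‖ := by
  classical
  induction s using Finset.induction_on with
  | empty => simp
  | insert i s hi ih =>
    rw [Finset.prod_insert hi, Finset.prod_insert hi, Finset.sum_insert hi]
    have h1 : ‖∏ j ∈ s, f j‖ ≤ 1 := by
      rw [norm_prod]
      exact Finset.prod_le_one (fun _ _ => norm_nonneg _)
        fun j hj => hf j (Finset.mem_insert_of_mem hj)
    have h2 := ih (fun j hj => hf j (Finset.mem_insert_of_mem hj))
      (fun j hj => hg j (Finset.mem_insert_of_mem hj))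
    have h3 := hg i (Finset.mem_insert_self i s)
    calc ‖f i * ∏ j ∈ s, f j - g i * ∏ j ∈ s, g j‖
        = ‖(f i - g i) * ∏ j ∈ s, f j + g i * (∏ j ∈ s, f j - ∏ j ∈ s, g j)‖ := by
          congr 1
          ring
      _ ≤ ‖f i - g i‖ * ‖∏ j ∈ s, f j‖ + ‖g i‖ * ‖∏ j ∈ s, f j - ∏ j ∈ s, g j‖ := by
          refine (norm_add_le _ _).trans_eq ?_
          rw [norm_mul, norm_mul]
      _ ≤ ‖f i - g i‖ * 1 + 1 * ∑ j ∈ s, ‖f j - g j‖ := by gcongr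
      _ = _ := by ring

section Lyapunov

variable {Ω : Type*} [MeasurableSpace Ω] {P : Measure Ω}

theorem integrable_abs_pow_three {ξ : Ω → ℝ} (hξ : MemLp ξ 3 P) :
    Integrable (fun ω => |ξ ω| ^ 3) P := by
  have := hξ.integrable_norm_pow (p := 3) (by norm_num)
  simpa using this

variable [IsProbabilityMeasure P]

/-- Integrate the third-order Taylor bound; the linear term disappears because the variable is
centred. -/
theorem norm_charFun_sub_le {ξ : Ω → ℝ} (hξ : MemLp ξ 3 P) (h0 : ∫ ω, ξ ω ∂P = 0) (t : ℝ) :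
    ‖charFun (P.map ξ) t - ((1 - (∫ ω, ξ ω ^ 2 ∂P) * t ^ 2 / 2 : ℝ) : ℂ)‖
      ≤ 4 * |t| ^ 3 * ∫ ω, |ξ ω| ^ 3 ∂P := by
  have hm : AEMeasurable ξ P := hξ.aestronglyMeasurable.aemeasurable
  have h1 : Integrable ξ P := hξ.integrable (by norm_num)
  have h2 : Integrable (fun ω => ξ ω ^ 2) P :=
    (hξ.mono_exponent (q := 3) (p := 2) (by norm_num)).integrable_sq
  have h3 := integrable_abs_pow_three hξ
  have hexp : Integrable (fun ω => Complex.exp (((t * ξ ω : ℝ) : ℂ) * Complex.I)) P := by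
    refine Integrable.of_bound (C := 1) ?_ (Eventually.of_forall fun ω => ?_)
    · have : AEMeasurable (fun ω => Complex.exp (((t * ξ ω : ℝ) : ℂ) * Complex.I)) P := by
        fun_prop
      exact this.aestronglyMeasurable
    · exact (Complex.norm_exp_ofReal_mul_I _).le
  have e1 : Integrable (fun ω => ((t * ξ ω : ℝ) : ℂ) * Complex.I) P :=
    (h1.const_mul t).ofReal.mul_const _
  have e2 : Integrable (fun ω => ((t * ξ ω : ℝ) : ℂ) ^ 2 / 2) P := by
    have := ((h2.const_mul (t ^ 2)).ofReal (𝕜 := ℂ)).div_const 2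
    refine this.congr (Eventually.of_forall fun ω => ?_)
    simp only [Complex.ofReal_mul, Complex.coe_algebraMap, Complex.ofReal_pow, mul_pow]
  have e3 : Integrable (fun ω => (1 : ℂ) + ((t * ξ ω : ℝ) : ℂ) * Complex.I) P :=
    (integrable_const _).add e1
  have hpoly : Integrable (fun ω => (1 : ℂ) + ((t * ξ ω : ℝ) : ℂ) * Complex.I
      - ((t * ξ ω : ℝ) : ℂ) ^ 2 / 2) P := e3.sub e2
  have hpi : ∫ ω, ((1 : ℂ) + ((t * ξ ω : ℝ) : ℂ) * Complex.I - ((t * ξ ω : ℝ) : ℂ) ^ 2 / 2) ∂P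
      = ((1 - (∫ ω, ξ ω ^ 2 ∂P) * t ^ 2 / 2 : ℝ) : ℂ) := by
    rw [integral_sub e3 e2, integral_add (integrable_const _) e1,
      integral_mul_const, integral_complex_ofReal, integral_const_mul, h0]
    have e4 : ∫ ω, ((t * ξ ω : ℝ) : ℂ) ^ 2 / 2 ∂P = (((∫ ω, ξ ω ^ 2 ∂P) * t ^ 2 / 2 : ℝ) : ℂ) := by
      rw [← integral_mul_const, ← integral_div, ← integral_complex_ofReal]
      refine integral_congr_ae (Eventually.of_forall fun ω => ?_)
      simp only
      push_cast
      ring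
    rw [e4]
    simp
  have hchar : charFun (P.map ξ) t = ∫ ω, Complex.exp (((t * ξ ω : ℝ) : ℂ) * Complex.I) ∂P := by
    rw [charFun_apply_real, integral_map hm (by fun_prop)]
    simp
  rw [hchar, ← hpi, ← integral_sub hexp hpoly, ← integral_const_mul]
  refine norm_integral_le_of_norm_le (h3.const_mul _) (Eventually.of_forall fun ω => ?_)
  refine (norm_exp_mul_I_sub_le _).trans_eq ?_
  rw [abs_mul]
  ring

/-- The square of the second moment is controlled by the third absolute moment. -/
theorem sq_integral_sq_le {ξ : Ω → ℝ} (hξ : MemLp ξ 3 P) :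
    (∫ ω, ξ ω ^ 2 ∂P) ^ 2 ≤ (1 + ∫ ω, ξ ω ^ 2 ∂P) * ∫ ω, |ξ ω| ^ 3 ∂P := by
  set v := ∫ ω, ξ ω ^ 2 ∂P with hv
  have h2 : Integrable (fun ω => ξ ω ^ 2) P :=
    (hξ.mono_exponent (q := 3) (p := 2) (by norm_num)).integrable_sq
  have h3 := integrable_abs_pow_three hξ
  have hv0 : 0 ≤ v := integral_nonneg fun ω => sq_nonneg _
  have h1 : Integrable (fun ω => 1 + ξ ω ^ 2) P := (integrable_const 1).add h2
  -- With y = |ξ|, expanding y(y - l)² ≥ 0 gives 2ly² - l²y ≤ y³, and y ≤ (1 + y²)/2. This stands in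
  -- for the Cauchy–Schwarz inequality.
  have key : ∀ l : ℝ, 2 * l * v - l ^ 2 * ((1 + v) / 2) ≤ ∫ ω, |ξ ω| ^ 3 ∂P := by
    intro l
    have : ∫ ω, (2 * l * ξ ω ^ 2 - l ^ 2 * ((1 + ξ ω ^ 2) / 2)) ∂P ≤ ∫ ω, |ξ ω| ^ 3 ∂P := by
      refine integral_mono ((h2.const_mul _).sub
        ((h1.div_const 2).const_mul _)) h3 fun ω => ?_
      simp only
      have e1 : ξ ω ^ 2 = |ξ ω| ^ 2 := (sq_abs _).symm
      rw [e1]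
      have e2 : 0 ≤ |ξ ω| * (|ξ ω| - l) ^ 2 := by positivity
      have e3 : 0 ≤ l ^ 2 * (1 - |ξ ω|) ^ 2 := by positivity
      nlinarith
    rw [integral_sub (h2.const_mul _) ((h1.div_const 2).const_mul _),
      integral_const_mul, integral_const_mul, integral_div,
      integral_add (integrable_const 1) h2] at this
    simpa using this
  -- This l maximises the left-hand side.
  have h4 := key (2 * v / (1 + v))
  have h5 : 0 < 1 + v := by linarith
  have h6 : 2 * (2 * v / (1 + v)) * v - (2 * v / (1 + v)) ^ 2 * ((1 + v) / 2)
      = 2 * v ^ 2 / (1 + v) := by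
    field_simp
    ring
  rw [h6, div_le_iff₀ h5] at h4
  nlinarith [sq_nonneg v]

/-- **Lyapunov's central limit theorem** for triangular arrays with third moments. -/
theorem tendstoInDistribution_of_lyapunov {ξ : ℕ → ℕ → Ω → ℝ} {v : ℝ}
    (hind : ∀ n, iIndepFun (ξ n) P) (hL : ∀ n k, MemLp (ξ n k) 3 P)
    (h0 : ∀ n k, ∫ ω, ξ n k ω ∂P = 0)
    (hv : Tendsto (fun n => ∑ k ∈ Finset.range n, ∫ ω, ξ n k ω ^ 2 ∂P) atTop (𝓝 v))
    (h3 : Tendsto (fun n => ∑ k ∈ Finset.range n, ∫ ω, |ξ n k ω| ^ 3 ∂P) atTop (𝓝 0)) :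
    TendstoInDistribution (fun n ω => ∑ k ∈ Finset.range n, ξ n k ω) atTop (id : ℝ → ℝ)
      (fun _ => P) (gaussianReal 0 v.toNNReal) where
  forall_aemeasurable n := Finset.aemeasurable_fun_sum _ fun k _ =>
    (hL n k).aestronglyMeasurable.aemeasurable
  tendsto := by
    refine ProbabilityMeasure.tendsto_iff_tendsto_charFun.2 fun t => ?_
    have hm : ∀ n k, AEMeasurable (ξ n k) P := fun n k =>
      (hL n k).aestronglyMeasurable.aemeasurable
    have hv0 : 0 ≤ v := ge_of_tendsto' hv fun n =>
      Finset.sum_nonneg fun k _ => integral_nonneg fun ω => sq_nonneg _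
    simp only [ProbabilityMeasure.coe_mk, Measure.map_id, charFun_gaussianReal,
      Real.coe_toNNReal v hv0]
    set V : ℕ → ℕ → ℝ := fun n k => ∫ ω, ξ n k ω ^ 2 ∂P with hV
    set L : ℕ → ℕ → ℝ := fun n k => ∫ ω, |ξ n k ω| ^ 3 ∂P with hLdef
    have hV0 : ∀ n k, 0 ≤ V n k := fun n k => integral_nonneg fun ω => sq_nonneg _
    have hL0 : ∀ n k, 0 ≤ L n k := fun n k => integral_nonneg fun ω => by positivity
    have hprod : ∀ n, charFun (P.map fun ω => ∑ k ∈ Finset.range n, ξ n k ω) t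
        = ∏ k ∈ Finset.range n, charFun (P.map (ξ n k)) t := fun n => by
      rw [((hind n).restrict _).charFun_map_fun_finsetSum_eq_prod (fun _ _ => hm n _)]
      simp
    have hgauss : Tendsto (fun n => ∏ k ∈ Finset.range n,
        ((Real.exp (-(V n k * t ^ 2 / 2)) : ℝ) : ℂ)) atTop
        (𝓝 (Complex.exp (t * (0 : ℝ) * Complex.I - v * t ^ 2 / 2))) := by
      have e1 : ∀ n, ∏ k ∈ Finset.range n, ((Real.exp (-(V n k * t ^ 2 / 2)) : ℝ) : ℂ)
          = ((Real.exp (-((∑ k ∈ Finset.range n, V n k) * t ^ 2 / 2)) : ℝ) : ℂ) := fun n => by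
        rw [← Complex.ofReal_prod, ← Real.exp_sum, Finset.sum_neg_distrib, Finset.sum_mul,
          Finset.sum_div]
      simp only [e1]
      have e2 : Complex.exp (t * (0 : ℝ) * Complex.I - v * t ^ 2 / 2)
          = ((Real.exp (-(v * t ^ 2 / 2)) : ℝ) : ℂ) := by
        push_cast
        congr 1
        ring
      rw [e2]
      exact (Complex.continuous_ofReal.tendsto _).comp ((Real.continuous_exp.tendsto _).comp
        (((hv.mul_const _).div_const 2).neg))
    -- Each characteristic function is compared with 1 - Vt²/2, and that with exp(-Vt²/2). The
    -- second error is quadratic in V, so `sq_integral_sq_le` bounds it by third moments as well; no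
    -- separate negligibility of the largest variance is needed.
    have hbound : ∀ n, ‖∏ k ∈ Finset.range n, charFun (P.map (ξ n k)) t
        - ∏ k ∈ Finset.range n, ((Real.exp (-(V n k * t ^ 2 / 2)) : ℝ) : ℂ)‖
        ≤ (4 * |t| ^ 3 + (1 + ∑ k ∈ Finset.range n, V n k) * t ^ 4 / 4)
          * ∑ k ∈ Finset.range n, L n k := fun n => by
      refine (norm_prod_sub_prod_le _ _ _ (fun k _ => ?_) fun k _ => ?_).trans ?_
      · have := Measure.isProbabilityMeasure_map (hm n k)
        exact norm_charFun_le_one t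
      · rw [Complex.norm_real, Real.norm_eq_abs, Real.abs_exp, Real.exp_le_one_iff]
        have := hV0 n k
        have : 0 ≤ V n k * t ^ 2 / 2 := by positivity
        linarith
      rw [Finset.mul_sum]
      refine Finset.sum_le_sum fun k hk => ?_
      have e1 := norm_charFun_sub_le (hL n k) (h0 n k) t
      have e2 := abs_exp_neg_sub_le (y := V n k * t ^ 2 / 2) (by have := hV0 n k; positivity)
      have e3 : (V n k) ^ 2 ≤ (1 + V n k) * L n k := sq_integral_sq_le (hL n k)
      have e4 : V n k ≤ ∑ k ∈ Finset.range n, V n k :=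
        Finset.single_le_sum (fun j _ => hV0 n j) hk
      have e5 : ‖((1 - V n k * t ^ 2 / 2 : ℝ) : ℂ)
          - ((Real.exp (-(V n k * t ^ 2 / 2)) : ℝ) : ℂ)‖ ≤ (V n k * t ^ 2 / 2) ^ 2 := by
        rw [← Complex.ofReal_sub, Complex.norm_real, Real.norm_eq_abs, abs_sub_comm]
        exact e2
      have e6 : (V n k * t ^ 2 / 2) ^ 2
          ≤ (1 + ∑ k ∈ Finset.range n, V n k) * t ^ 4 / 4 * L n k := by
        have e7 : (V n k) ^ 2 ≤ (1 + ∑ k ∈ Finset.range n, V n k) * L n k :=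
          e3.trans (mul_le_mul_of_nonneg_right (by linarith) (hL0 n k))
        have := mul_le_mul_of_nonneg_left e7 (show 0 ≤ t ^ 4 / 4 by positivity)
        linarith
      refine (norm_sub_le_norm_sub_add_norm_sub _ ((1 - V n k * t ^ 2 / 2 : ℝ) : ℂ) _).trans ?_
      rw [add_mul]
      exact add_le_add e1 (e5.trans e6)
    have hlim : Tendsto (fun n => (4 * |t| ^ 3 + (1 + ∑ k ∈ Finset.range n, V n k) * t ^ 4 / 4)
          * ∑ k ∈ Finset.range n, L n k) atTop (𝓝 0) := by
      have := ((((hv.const_add 1).mul_const (t ^ 4)).div_const 4).const_add (4 * |t| ^ 3)).mul h3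
      rwa [mul_zero] at this
    have hdiff := squeeze_zero_norm hbound hlim
    have := hdiff.add hgauss
    simp only [sub_add_cancel, zero_add] at this
    simpa only [hprod] using this

end Lyapunov

/-! ### Kernel smoothing of bounded functions -/

/-- Second-order difference quotient of `m` at `x`. -/
noncomputable def secondQuotient (m : ℝ → ℝ) (x u : ℝ) : ℝ :=
  (m (x - u) - m x + u * deriv m x) / u ^ 2

/-- Subtract the quadratic Taylor polynomial: the derivative of the remainder is o(|y - x|) by
differentiability of m' at x alone, and the mean value inequality on the ball of radius |u| gives
o(u²). -/
theorem TwiceDifferentiableAt.tendsto_secondQuotient {m : ℝ → ℝ} {x : ℝ}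
    (hm : TwiceDifferentiableAt m x) :
    Tendsto (secondQuotient m x) (𝓝[≠] 0) (𝓝 (iteratedDeriv 2 m x / 2)) := by
  rw [iteratedDeriv_succ, iteratedDeriv_one]
  set b := deriv (deriv m) x with hb
  rw [Metric.tendsto_nhds]
  intro ε hε
  have hd := (hasDerivAt_iff_isLittleO.1 hm.2.hasDerivAt).def (half_pos hε)
  obtain ⟨r, hr, hball⟩ := Metric.eventually_nhds_iff_ball.1 (hm.1.and hd)
  have hnear : ∀ᶠ u : ℝ in 𝓝[≠] 0, u ∈ Metric.ball (0 : ℝ) r :=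
    nhdsWithin_le_nhds (Metric.ball_mem_nhds _ hr)
  filter_upwards [hnear, self_mem_nhdsWithin] with u hu hu0
  have hu0 : u ≠ 0 := hu0
  rw [Metric.mem_ball, dist_zero_right, Real.norm_eq_abs] at hu
  set F : ℝ → ℝ := fun y => m y - deriv m x * (y - x) - b / 2 * (y - x) ^ 2 with hF
  have hsub : ∀ y ∈ Metric.closedBall x |u|, y ∈ Metric.ball x r := fun y hy =>
    Metric.closedBall_subset_ball hu hy
  have hderiv : ∀ y ∈ Metric.closedBall x |u|,
      HasDerivWithinAt F (deriv m y - deriv m x - (y - x) * b) (Metric.closedBall x |u|) y := by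
    intro y hy
    have h1 := (hball y (hsub y hy)).1.hasDerivAt
    have h2 : HasDerivAt (fun y => y - x) 1 y := (hasDerivAt_id y).sub_const x
    have h3 := (h1.sub (h2.const_mul (deriv m x))).sub ((h2.pow 2).const_mul (b / 2))
    refine HasDerivAt.hasDerivWithinAt (h3.congr_deriv ?_)
    simp only [Nat.cast_ofNat]
    ring
  have hbd : ∀ y ∈ Metric.closedBall x |u|,
      ‖deriv m y - deriv m x - (y - x) * b‖ ≤ ε / 2 * |u| := by
    intro y hy
    refine ((hball y (hsub y hy)).2).trans ?_
    have : ‖y - x‖ ≤ |u| := by simpa [dist_eq_norm] using hy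
    gcongr
  have hmv := Convex.norm_image_sub_le_of_norm_hasDerivWithin_le hderiv hbd
    (convex_closedBall x |u|) (Metric.mem_closedBall_self (abs_nonneg u))
    (show x - u ∈ Metric.closedBall x |u| by simp)
  have h4 : F (x - u) - F x = m (x - u) - m x + u * deriv m x - b / 2 * u ^ 2 := by
    simp only [hF]
    ring
  have h5 : ‖x - u - x‖ = |u| := by simp
  rw [h4, h5, Real.norm_eq_abs] at hmv
  have h6 : secondQuotient m x u - b / 2
      = (m (x - u) - m x + u * deriv m x - b / 2 * u ^ 2) / u ^ 2 := by
    rw [secondQuotient]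
    field_simp
  have hupos : 0 < u ^ 2 := by positivity
  rw [Real.dist_eq, h6, abs_div, abs_of_pos hupos, div_lt_iff₀ hupos]
  rw [mul_assoc, ← sq, sq_abs] at hmv
  nlinarith

/-- Near 0 the quotient is close to its limit; away from 0 its numerator grows at most linearly
since m is bounded. The global bound supplies the dominating function z²|K(z)| for the bias
expansion. -/
theorem TwiceDifferentiableAt.exists_secondQuotient_le {m : ℝ → ℝ} {x C : ℝ}
    (hm : TwiceDifferentiableAt m x) (hC : ∀ s, |m s| ≤ C) :
    ∃ D, ∀ u, |secondQuotient m x u| ≤ D := by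
  set b := iteratedDeriv 2 m x / 2
  have h1 : ∀ᶠ u in 𝓝[≠] (0 : ℝ), |secondQuotient m x u| < |b| + 1 :=
    hm.tendsto_secondQuotient.abs.eventually (gt_mem_nhds (by linarith))
  rw [eventually_nhdsWithin_iff, Metric.eventually_nhds_iff_ball] at h1
  obtain ⟨r, hr, h1⟩ := h1
  have hC0 : 0 ≤ C := (abs_nonneg _).trans (hC x)
  refine ⟨|b| + 1 + ((C + C) / r ^ 2 + |deriv m x| / r), fun u => ?_⟩
  have hpos : 0 ≤ (C + C) / r ^ 2 + |deriv m x| / r := by positivity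
  rcases eq_or_ne u 0 with rfl | hu
  · simp only [secondQuotient, ne_eq, OfNat.ofNat_ne_zero, not_false_eq_true, zero_pow, div_zero,
      abs_zero]
    positivity
  rcases lt_or_ge |u| r with hur | hur
  · have := h1 u (by simpa using hur) hu
    linarith
  · have hu' : 0 < |u| := abs_pos.2 hu
    have h2 : |m (x - u) - m x + u * deriv m x| ≤ (C + C) + |u| * |deriv m x| := by
      refine (abs_add_le _ _).trans (add_le_add ((abs_sub _ _).trans (add_le_add (hC _) (hC _))) ?_)
      rw [abs_mul]
    have h3 : |secondQuotient m x u| ≤ (C + C) / |u| ^ 2 + |deriv m x| / |u| := by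
      rw [secondQuotient, abs_div, abs_of_nonneg (sq_nonneg u), ← sq_abs u]
      calc _ ≤ ((C + C) + |u| * |deriv m x|) / |u| ^ 2 := by gcongr
        _ = _ := by field_simp
    have h4 : (C + C) / |u| ^ 2 + |deriv m x| / |u| ≤ (C + C) / r ^ 2 + |deriv m x| / r := by
      gcongr
    have := abs_nonneg b
    linarith

/-- Smoothing at vanishing bandwidths recovers the value of a bounded function at a point of
continuity. -/
theorem tendsto_integral_smoothing {L m : ℝ → ℝ} {h : ℕ → ℝ} {x C : ℝ} (hL : Integrable L)
    (hmm : Measurable m) (hC : ∀ s, |m s| ≤ C) (hm : ContinuousAt m x)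
    (hh : Tendsto h atTop (𝓝 0)) :
    Tendsto (fun n => ∫ z, L z * m (x - h n * z)) atTop (𝓝 (m x * ∫ z, L z)) := by
  rw [mul_comm, ← integral_mul_const]
  refine tendsto_integral_of_dominated_convergence (fun z => |L z| * C) (fun n => ?_)
    (hL.abs.mul_const C) (fun n => Eventually.of_forall fun z => ?_)
    (Eventually.of_forall fun z => ?_)
  · exact hL.aestronglyMeasurable.mul (hmm.comp (by fun_prop)).aestronglyMeasurable
  · rw [norm_mul, Real.norm_eq_abs, Real.norm_eq_abs]
    gcongr
    exact hC _
  · refine Tendsto.const_mul _ (hm.tendsto.comp ?_)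
    have := (hh.mul_const z).const_sub x
    rwa [zero_mul, sub_zero] at this

theorem KernelAssumption.integrable_mul {K : ℝ → ℝ} (hK : KernelAssumption K) {m : ℝ → ℝ} {C : ℝ}
    (hmm : Measurable m) (hC : ∀ s, |m s| ≤ C) (x h : ℝ) :
    Integrable fun z => K z * m (x - h * z) :=
  hK.integrable.mul_bdd (hmm.comp (by fun_prop)).aestronglyMeasurable
    (Eventually.of_forall fun z => hC _)

/-- The second-order expansion of the bias of kernel smoothing. -/
theorem KernelAssumption.tendsto_bias {K : ℝ → ℝ} (hK : KernelAssumption K) {m : ℝ → ℝ}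
    {h : ℕ → ℝ} {x C : ℝ} (hmm : Measurable m) (hC : ∀ s, |m s| ≤ C)
    (hm : TwiceDifferentiableAt m x) (hh : Tendsto h atTop (𝓝 0)) (hh0 : ∀ᶠ n in atTop, h n ≠ 0) :
    Tendsto (fun n => ((∫ z, K z * m (x - h n * z)) - m x) / h n ^ 2) atTop
      (𝓝 (iteratedDeriv 2 m x / 2 * kernelMoment 2 K)) := by
  obtain ⟨D, hD⟩ := hm.exists_secondQuotient_le hC
  have hQm : Measurable (secondQuotient m x) := by
    unfold secondQuotient
    fun_prop
  have hlim : Tendsto (fun n => ∫ z, z ^ 2 * K z * secondQuotient m x (h n * z)) atTop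
      (𝓝 (∫ z, z ^ 2 * K z * (iteratedDeriv 2 m x / 2))) := by
    refine tendsto_integral_of_dominated_convergence (fun z => |z ^ 2 * K z| * D) (fun n => ?_)
      (hK.integrable_second.abs.mul_const D) (fun n => Eventually.of_forall fun z => ?_)
      (Eventually.of_forall fun z => ?_)
    · exact hK.integrable_second.aestronglyMeasurable.mul
        (hQm.comp (by fun_prop)).aestronglyMeasurable
    · rw [norm_mul, Real.norm_eq_abs, Real.norm_eq_abs]
      gcongr
      exact hD _
    -- The quotient converges along nonzero arguments only; at z = 0 the factor z² annihilates the
    -- integrand.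
    · rcases eq_or_ne z 0 with rfl | hz
      · simp
      · refine Tendsto.const_mul _ (hm.tendsto_secondQuotient.comp ?_)
        refine tendsto_nhdsWithin_iff.2 ⟨?_, hh0.mono fun n hn => mul_ne_zero hn hz⟩
        have := hh.mul_const z
        rwa [zero_mul] at this
  rw [integral_mul_const, mul_comm] at hlim
  refine hlim.congr' ?_
  filter_upwards [hh0] with n hn
  -- The first-order term built into the quotient costs nothing, as ∫ zK(z) dz = 0.
  have e1 : ∀ z, z ^ 2 * K z * secondQuotient m x (h n * z)
      = (K z * m (x - h n * z) - m x * K z + h n * deriv m x * (z * K z)) / h n ^ 2 := by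
    intro z
    rcases eq_or_ne z 0 with rfl | hz
    · simp [mul_comm]
    · rw [secondQuotient]
      field_simp
  have i1 := hK.integrable_mul hmm hC x (h n)
  have i2 : Integrable fun z => K z * m (x - h n * z) - m x * K z := i1.sub (hK.integrable.const_mul _)
  simp only [e1]
  rw [integral_div, integral_add i2 (hK.integrable_first.const_mul _),
    integral_sub i1 (hK.integrable.const_mul _), integral_const_mul, integral_const_mul,
    hK.integral_eq_one, hK.first_moment]
  ring

theorem KernelAssumption.integrable_sq {K : ℝ → ℝ} (hK : KernelAssumption K) :
    Integrable fun z => K z ^ 2 := by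
  obtain ⟨C, hC⟩ := hK.bounded
  simp only [sq]
  exact hK.integrable.mul_bdd hK.continuous.aestronglyMeasurable (Eventually.of_forall hC)

theorem KernelAssumption.integrable_pow_three {K : ℝ → ℝ} (hK : KernelAssumption K) :
    Integrable fun z => |K z| ^ 3 := by
  obtain ⟨C, hC⟩ := hK.bounded
  have := (hK.integrable_sq.mul_bdd hK.continuous.aestronglyMeasurable
    (Eventually.of_forall hC)).abs
  refine this.congr (Eventually.of_forall fun z => ?_)
  simp only [abs_mul, abs_pow]
  ring

/-! ### Expectations under the joint density -/

theorem integral_scaled_kernel (L m : ℝ → ℝ) (x : ℝ) {h : ℝ} (hh : 0 < h) :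
    ∫ s, h⁻¹ * L ((x - s) / h) * m s = ∫ z, L z * m (x - h * z) := by
  have h1 := integral_sub_left_eq_self (fun u => h⁻¹ * L (u / h) * m (x - u)) volume x
  simp only [sub_sub_cancel] at h1
  have h2 := Measure.integral_comp_div (fun z => h⁻¹ * (L z * m (x - h * z))) h
  rw [integral_const_mul (h⁻¹) fun z => L z * m (x - h * z), abs_of_pos hh, smul_eq_mul,
    mul_inv_cancel_left₀ hh.ne'] at h2
  rw [h1, ← h2]
  refine integral_congr_ae (Eventually.of_forall fun u => ?_)
  simp only
  rw [mul_div_cancel₀ u hh.ne', mul_assoc]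

theorem moment_zero (g : ℝ → ℝ → ℝ) : moment g 0 = density g := by
  ext s
  simp [moment, density]

namespace IsIIDSample

variable {Ω : Type*} [MeasurableSpace Ω] {P : Measure Ω} {X Y : ℕ → Ω → ℝ} {g : ℝ → ℝ → ℝ}

theorem measurable_section (hS : IsIIDSample P X Y g) (s : ℝ) : Measurable (g s) :=
  hS.measurable_density.comp measurable_prodMk_left

theorem measurable_moment (hS : IsIIDSample P X Y g) (q : ℕ) : Measurable (moment g q) := by
  have : Measurable (Function.uncurry fun s t : ℝ => t ^ q * g s t) :=
    (measurable_snd.pow_const q).mul hS.measurable_density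
  exact this.stronglyMeasurable.integral_prod_right.measurable

section Product

variable (hS : IsIIDSample P X Y g) {ψ η : ℝ → ℝ} {C : ℝ} (hψm : Measurable ψ)
  (hψ : Integrable ψ) (hη : Measurable η) (hint : ∀ s, Integrable fun t => η t * g s t)
  (hC : ∀ s, ∫ t, |η t| * g s t ≤ C)
include hS hψm hψ hη hint hC

/-- Fubini's criterion: the uniform bound C on the inner absolute integral dominates the outer one
by C|ψ|. -/
theorem integrable_prod_density :
    Integrable (fun p : ℝ × ℝ => ψ p.1 * (η p.2 * g p.1 p.2)) (volume.prod volume) := by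
  have hmeas : Measurable fun p : ℝ × ℝ => ψ p.1 * (η p.2 * g p.1 p.2) :=
    (hψm.comp measurable_fst).mul ((hη.comp measurable_snd).mul hS.measurable_density)
  refine (integrable_prod_iff hmeas.aestronglyMeasurable).2
    ⟨Eventually.of_forall fun s => (hint s).const_mul (ψ s), ?_⟩
  refine (hψ.abs.mul_const C).mono'
    (hmeas.norm.stronglyMeasurable.integral_prod_right').aestronglyMeasurable
    (Eventually.of_forall fun s => ?_)
  have h1 : ∀ t, ‖ψ s * (η t * g s t)‖ = |ψ s| * (|η t| * g s t) := fun t => by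
    rw [norm_mul, norm_mul, Real.norm_eq_abs, Real.norm_eq_abs, Real.norm_eq_abs,
      abs_of_nonneg (hS.nonneg s t)]
  have h2 : 0 ≤ ∫ t, |η t| * g s t :=
    integral_nonneg fun t => mul_nonneg (abs_nonneg _) (hS.nonneg s t)
  simp only [h1, integral_const_mul]
  rw [norm_mul, Real.norm_eq_abs, Real.norm_eq_abs, abs_abs, abs_of_nonneg h2]
  gcongr
  exact hC s

theorem integrable_mul_comp {k : ℕ} (hk : 1 ≤ k) :
    Integrable (fun ω => ψ (X k ω) * η (Y k ω)) P := by
  have hmeas : Measurable fun p : ℝ × ℝ => ψ p.1 * η p.2 :=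
    (hψm.comp measurable_fst).mul (hη.comp measurable_snd)
  have h1 : Integrable (fun p : ℝ × ℝ => ψ p.1 * η p.2)
      (volume.withDensity fun p => ENNReal.ofReal (g p.1 p.2)) := by
    have hgm : Measurable fun p : ℝ × ℝ => ENNReal.ofReal (g p.1 p.2) :=
      hS.measurable_density.ennreal_ofReal
    refine (integrable_withDensity_iff hgm (Eventually.of_forall fun p => ENNReal.ofReal_lt_top)).2 ?_
    refine (hS.integrable_prod_density hψm hψ hη hint hC).congr
      (Eventually.of_forall fun p => ?_)
    simp only [ENNReal.toReal_ofReal (hS.nonneg p.1 p.2)]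
    ring
  rw [← (hS.law k hk).map_eq] at h1
  exact h1.comp_aemeasurable (hS.law k hk).aemeasurable

theorem integral_mul_comp {k : ℕ} (hk : 1 ≤ k) :
    ∫ ω, ψ (X k ω) * η (Y k ω) ∂P = ∫ s, ψ s * ∫ t, η t * g s t := by
  have hmeas : Measurable fun p : ℝ × ℝ => ψ p.1 * η p.2 :=
    (hψm.comp measurable_fst).mul (hη.comp measurable_snd)
  have h1 := (hS.law k hk).integral_comp (f := fun p : ℝ × ℝ => ψ p.1 * η p.2)
    hmeas.aestronglyMeasurable
  have hgm : Measurable fun p : ℝ × ℝ => ENNReal.ofReal (g p.1 p.2) :=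
    hS.measurable_density.ennreal_ofReal
  rw [integral_withDensity_eq_integral_toReal_smul hgm (Eventually.of_forall fun p => ENNReal.ofReal_lt_top)] at h1
  refine h1.trans ?_
  have h2 := integral_prod _ (hS.integrable_prod_density hψm hψ hη hint hC)
  simp only [integral_const_mul] at h2
  rw [← h2]
  refine integral_congr_ae (Eventually.of_forall fun p => ?_)
  simp only [ENNReal.toReal_ofReal (hS.nonneg p.1 p.2), smul_eq_mul]
  ring

end Product

/-! ### Moments of scaled kernel observations. -/

section Kernel

variable {x : ℝ} (hS : IsIIDSample P X Y g) (hg : DensityAssumption g x)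
include hS hg

theorem integrable_moment {q : ℕ} (hq : q ≤ 3) (s : ℝ) : Integrable fun t => t ^ q * g s t := by
  rcases hq.lt_or_eq with hq | rfl
  · exact hg.integrable_moment q (by omega) s
  · have h1 := hg.integrable_absMoment (3 : ℕ) (by norm_num) (by norm_num) s
    simp only [Real.rpow_natCast] at h1
    refine (integrable_norm_iff ?_).1 (h1.congr (Eventually.of_forall fun t => ?_))
    · exact ((measurable_id.pow_const 3).mul (hS.measurable_section s)).aestronglyMeasurable
    · simp only [norm_mul, norm_pow, Real.norm_eq_abs, abs_of_nonneg (hS.nonneg s t)]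

theorem exists_absMoment_le {q : ℕ} (hq : q ≤ 3) : ∃ C, ∀ s, ∫ t, |t ^ q| * g s t ≤ C := by
  obtain ⟨C₂, hC₂⟩ := hg.bounded_absMoment 2 le_rfl (by norm_num)
  obtain ⟨C₃, hC₃⟩ := hg.bounded_absMoment (3 : ℕ) (by norm_num) (by norm_num)
  obtain ⟨C₀, hC₀⟩ := hg.bounded_moment 0 (by norm_num)
  simp only [Real.rpow_natCast, Real.rpow_two, sq_abs] at hC₂ hC₃
  have h0 : ∀ s, ∫ t, g s t ≤ C₀ := fun s => by
    simpa [moment] using (le_abs_self _).trans (hC₀ s)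
  have i0 : ∀ s, Integrable (g s) := fun s => by
    simpa using hg.integrable_moment 0 (by norm_num) s
  interval_cases q
  · exact ⟨C₀, fun s => by simpa using h0 s⟩
  -- The assumption for q = 1 bounds only the signed moment, so the absolute one is bounded through
  -- |t| ≤ 1 + t².
  · refine ⟨C₀ + C₂, fun s => ?_⟩
    refine (integral_mono (g := fun t => g s t + t ^ 2 * g s t) ?_
      ((i0 s).add (hg.integrable_moment 2 le_rfl s)) fun t => ?_).trans ?_
    · refine (hg.integrable_moment 1 (by norm_num) s).abs.congr (Eventually.of_forall fun t => ?_)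
      simp only [abs_mul, abs_of_nonneg (hS.nonneg s t)]
    · have h1 : |t ^ 1| ≤ 1 + t ^ 2 := by
        rw [pow_one, ← sq_abs]
        nlinarith [sq_nonneg (|t| - 1), abs_nonneg t]
      have := mul_le_mul_of_nonneg_right h1 (hS.nonneg s t)
      simp only
      linarith
    · rw [integral_add (i0 s) (hg.integrable_moment 2 le_rfl s)]
      exact add_le_add (h0 s) (hC₂ s)
  · exact ⟨C₂, fun s => by simpa using hC₂ s⟩
  · exact ⟨C₃, fun s => by simpa only [abs_pow] using hC₃ s⟩

variable {L : ℝ → ℝ} (hLc : Continuous L) (hL : Integrable L)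
include hLc hL

theorem integrable_kernel {q k : ℕ} (hq : q ≤ 3) (hk : 1 ≤ k) {h : ℝ} (hh : 0 < h) :
    Integrable (fun ω => h⁻¹ * L ((x - X k ω) / h) * Y k ω ^ q) P := by
  obtain ⟨C, hC⟩ := hS.exists_absMoment_le hg hq
  have hm := hLc.measurable
  exact hS.integrable_mul_comp (ψ := fun s => h⁻¹ * L ((x - s) / h)) (by fun_prop)
    (((hL.comp_div hh.ne').comp_sub_left x).const_mul _) (measurable_id.pow_const q)
    (hS.integrable_moment hg hq) hC hk

theorem integral_kernel {q k : ℕ} (hq : q ≤ 3) (hk : 1 ≤ k) {h : ℝ} (hh : 0 < h) :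
    ∫ ω, h⁻¹ * L ((x - X k ω) / h) * Y k ω ^ q ∂P = ∫ z, L z * moment g q (x - h * z) := by
  obtain ⟨C, hC⟩ := hS.exists_absMoment_le hg hq
  have hm := hLc.measurable
  rw [hS.integral_mul_comp (ψ := fun s => h⁻¹ * L ((x - s) / h)) (η := fun t => t ^ q) (by fun_prop)
    (((hL.comp_div hh.ne').comp_sub_left x).const_mul _) (by fun_prop)
    (hS.integrable_moment hg hq) hC hk]
  exact integral_scaled_kernel L (moment g q) x hh

/-- The substitution s = x - hz absorbs h⁻¹, which makes the bound uniform in the bandwidth. Applied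
to |K|³ it controls third moments. -/
theorem exists_integral_abs_kernel_le {q : ℕ} (hq : q ≤ 3) :
    ∃ C, 0 ≤ C ∧ ∀ k, 1 ≤ k → ∀ h : ℝ, 0 < h →
      ∫ ω, |h⁻¹ * L ((x - X k ω) / h) * Y k ω ^ q| ∂P ≤ C := by
  obtain ⟨C, hC⟩ := hS.exists_absMoment_le hg hq
  have hC0 : 0 ≤ C := (integral_nonneg fun t => mul_nonneg (abs_nonneg _) (hS.nonneg 0 t)).trans
    (hC 0)
  refine ⟨C * ∫ z, |L z|, mul_nonneg hC0 (integral_nonneg fun z => abs_nonneg _),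
    fun k hk h hh => ?_⟩
  have hm := hLc.measurable
  have hi : ∀ s, Integrable fun t => |t ^ q| * g s t := fun s =>
    (hS.integrable_moment hg hq s).abs.congr (Eventually.of_forall fun t => by
      simp only [abs_mul, abs_of_nonneg (hS.nonneg s t)])
  have h1 := hS.integral_mul_comp (ψ := fun s => h⁻¹ * |L ((x - s) / h)|)
    (η := fun t => |t ^ q|) (C := C) (by fun_prop)
    (((hL.abs.comp_div hh.ne').comp_sub_left x).const_mul _) (by fun_prop) hi
    (fun s => by simpa only [abs_abs] using hC s) hk
  rw [integral_scaled_kernel (fun z => |L z|) (fun s => ∫ t, |t ^ q| * g s t) x hh] at h1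
  have h2 : ∫ ω, |h⁻¹ * L ((x - X k ω) / h) * Y k ω ^ q| ∂P
      = ∫ ω, h⁻¹ * |L ((x - X k ω) / h)| * |Y k ω ^ q| ∂P := by
    refine integral_congr_ae (Eventually.of_forall fun ω => ?_)
    simp only [abs_mul, abs_of_pos (inv_pos.2 hh)]
  rw [h2, h1, ← integral_const_mul]
  refine integral_mono_of_nonneg (Eventually.of_forall fun z => mul_nonneg (abs_nonneg _)
    (integral_nonneg fun t => mul_nonneg (abs_nonneg _) (hS.nonneg _ t))) (hL.abs.const_mul _)
    (Eventually.of_forall fun z => ?_)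
  simp only
  rw [mul_comm C]
  exact mul_le_mul_of_nonneg_left (hC _) (abs_nonneg _)

end Kernel

end IsIIDSample

section Core

variable {Ω : Type*} [MeasurableSpace Ω] {P : Measure Ω} [IsProbabilityMeasure P]

/-! ### The central limit theorem for recursions -/

/-- Vanishing variances force convergence in probability of centred variables. -/
theorem tendstoInMeasure_of_variance {S : ℕ → Ω → ℝ} (hS : ∀ n, MemLp (S n) 2 P)
    (h0 : ∀ n, ∫ ω, S n ω ∂P = 0) (hv : Tendsto (fun n => Var[S n; P]) atTop (𝓝 0)) :
    TendstoInMeasure P S atTop (fun _ => 0) := by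
  rw [tendstoInMeasure_iff_norm]
  intro ε hε
  have h1 : Tendsto (fun n => ENNReal.ofReal (Var[S n; P] / ε ^ 2)) atTop (𝓝 0) := by
    have := ENNReal.tendsto_ofReal (hv.div_const (ε ^ 2))
    simpa using this
  refine tendsto_of_tendsto_of_tendsto_of_le_of_le tendsto_const_nhds h1
    (fun n => zero_le) fun n => ?_
  have := meas_ge_le_variance_div_sq (hS n) hε
  simpa only [h0 n, sub_zero, Real.norm_eq_abs] using this

variable {h : ℕ → ℝ} {a : ℝ} (hh : GS (-a) h) (ha : a < 1) {Z W : ℕ → Ω → ℝ}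
  (hind : iIndepFun (fun (k : ℕ) ω => (Z (k + 1) ω, W (k + 1) ω)) P)
  (hZ : ∀ k, 1 ≤ k → MemLp (Z k) 3 P) (hW : ∀ k, 1 ≤ k → MemLp (W k) 3 P)
  (hZ0 : ∀ k, 1 ≤ k → ∫ ω, Z k ω ∂P = 0) (hW0 : ∀ k, 1 ≤ k → ∫ ω, W k ω ∂P = 0)
  {v₁₁ v₁₂ v₂₂ : ℝ}
  (h₁₁ : Tendsto (fun n => h n * ∫ ω, Z n ω * Z n ω ∂P) atTop (𝓝 v₁₁))
  (h₁₂ : Tendsto (fun n => h n * ∫ ω, Z n ω * W n ω ∂P) atTop (𝓝 v₁₂))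
  (h₂₂ : Tendsto (fun n => h n * ∫ ω, W n ω * W n ω ∂P) atTop (𝓝 v₂₂))
  {C : ℝ} (hZ3 : ∀ k, 1 ≤ k → h k ^ 2 * ∫ ω, |Z k ω| ^ 3 ∂P ≤ C)
  (hW3 : ∀ k, 1 ≤ k → h k ^ 2 * ∫ ω, |W k ω| ^ 3 ∂P ≤ C)
  {s₁ s₂ : ℝ} (hs₁ : 1 - a ≤ s₁) (hs₁' : s₁ ≤ 1) (hs₂ : 1 - a ≤ s₂) (hs₂' : s₂ ≤ 1)

include hh ha hind hZ hW hZ0 hW0 h₁₁ h₁₂ h₂₂ hZ3 hW3 hs₁ hs₁' hs₂ hs₂' in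
/-- Asymptotic normality of a difference of two recursions driven by centred variables. -/
theorem tendstoInDistribution_recursion (r : ℝ) {V : ℝ}
    (hV : V = s₁ * s₁ * v₁₁ / (s₁ + s₁ - (1 - a)) - 2 * r * (s₁ * s₂ * v₁₂ / (s₁ + s₂ - (1 - a)))
      + r ^ 2 * (s₂ * s₂ * v₂₂ / (s₂ + s₂ - (1 - a)))) :
    0 ≤ V ∧ TendstoInDistribution (fun (n : ℕ) ω => √(n * h n) *
        (recursion (fun k => s₁ / (k : ℝ)) (fun k => Z k ω) n
          - r * recursion (fun k => s₂ / (k : ℝ)) (fun k => W k ω) n)) atTop (id : ℝ → ℝ)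
      (fun _ => P) (gaussianReal 0 V.toNNReal) := by
  set ξ : ℕ → ℕ → Ω → ℝ := fun n k ω => √(n * h n) *
    (weight s₁ (k + 1) n * Z (k + 1) ω - r * (weight s₂ (k + 1) n * W (k + 1) ω)) with hξ
  have hsum : (fun (n : ℕ) ω => √(n * h n) *
        (recursion (fun k => s₁ / (k : ℝ)) (fun k => Z k ω) n
          - r * recursion (fun k => s₂ / (k : ℝ)) (fun k => W k ω) n))
      = fun n ω => ∑ k ∈ Finset.range n, ξ n k ω := by
    ext n ω
    simp only [hξ]
    rw [recursion_eq_sum, recursion_eq_sum, ← Finset.mul_sum, Finset.sum_sub_distrib,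
      ← Finset.mul_sum]
  have hi1 : ∀ n k, MemLp (fun ω => weight s₁ (k + 1) n * Z (k + 1) ω) 3 P := fun n k =>
    (hZ (k + 1) (by omega)).const_mul _
  have hi2 : ∀ n k, MemLp (fun ω => r * (weight s₂ (k + 1) n * W (k + 1) ω)) 3 P := fun n k =>
    ((hW (k + 1) (by omega)).const_mul _).const_mul _
  have hL : ∀ n k, MemLp (ξ n k) 3 P := fun n k => ((hi1 n k).sub (hi2 n k)).const_mul _
  have hindξ : ∀ n, iIndepFun (ξ n) P := fun n =>
    hind.comp (fun k p => √(n * h n) * (weight s₁ (k + 1) n * p.1 - r * (weight s₂ (k + 1) n * p.2)))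
      fun k => by fun_prop
  have h0 : ∀ n k, ∫ ω, ξ n k ω ∂P = 0 := fun n k => by
    simp only [hξ]
    rw [integral_const_mul, integral_sub ((hi1 n k).integrable (by norm_num))
      ((hi2 n k).integrable (by norm_num)), integral_const_mul, integral_const_mul,
      integral_const_mul, hZ0 _ (by omega), hW0 _ (by omega)]
    simp
  have hpos : ∀ n : ℕ, 0 ≤ (n : ℝ) * h n := fun n => by
    rcases Nat.eq_zero_or_pos n with rfl | hn
    · simp
    · exact (natCast_mul_pos hh n hn).le
  have hsq : ∀ n k, ∫ ω, ξ n k ω ^ 2 ∂P = (n * h n) *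
      (weight s₁ (k + 1) n * weight s₁ (k + 1) n * ∫ ω, Z (k + 1) ω * Z (k + 1) ω ∂P)
      - 2 * r * ((n * h n) *
        (weight s₁ (k + 1) n * weight s₂ (k + 1) n * ∫ ω, Z (k + 1) ω * W (k + 1) ω ∂P))
      + r ^ 2 * ((n * h n) *
        (weight s₂ (k + 1) n * weight s₂ (k + 1) n * ∫ ω, W (k + 1) ω * W (k + 1) ω ∂P)) := by
    intro n k
    have z2 : MemLp (Z (k + 1)) 2 P :=
      (hZ (k + 1) (by omega)).mono_exponent (q := 3) (p := 2) (by norm_num)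
    have w2 : MemLp (W (k + 1)) 2 P :=
      (hW (k + 1) (by omega)).mono_exponent (q := 3) (p := 2) (by norm_num)
    have izz : Integrable (fun ω => Z (k + 1) ω * Z (k + 1) ω) P := z2.integrable_mul z2
    have izw : Integrable (fun ω => Z (k + 1) ω * W (k + 1) ω) P := z2.integrable_mul w2
    have iww : Integrable (fun ω => W (k + 1) ω * W (k + 1) ω) P := w2.integrable_mul w2
    have e : ∀ ω, ξ n k ω ^ 2 =
        ((n * h n * (weight s₁ (k + 1) n * weight s₁ (k + 1) n)) * (Z (k + 1) ω * Z (k + 1) ω)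
        - (2 * r * (n * h n * (weight s₁ (k + 1) n * weight s₂ (k + 1) n)))
          * (Z (k + 1) ω * W (k + 1) ω))
        + (r ^ 2 * (n * h n * (weight s₂ (k + 1) n * weight s₂ (k + 1) n)))
          * (W (k + 1) ω * W (k + 1) ω) := fun ω => by
      simp only [hξ]
      rw [mul_pow, Real.sq_sqrt (hpos n)]
      ring
    have i1 : Integrable (fun ω =>
        (n * h n * (weight s₁ (k + 1) n * weight s₁ (k + 1) n)) * (Z (k + 1) ω * Z (k + 1) ω)
        - (2 * r * (n * h n * (weight s₁ (k + 1) n * weight s₂ (k + 1) n)))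
          * (Z (k + 1) ω * W (k + 1) ω)) P := (izz.const_mul _).sub (izw.const_mul _)
    simp only [e]
    rw [integral_add i1 (iww.const_mul _), integral_sub (izz.const_mul _) (izw.const_mul _),
      integral_const_mul, integral_const_mul, integral_const_mul]
    ring
  have hlimV : Tendsto (fun n => ∑ k ∈ Finset.range n, ∫ ω, ξ n k ω ^ 2 ∂P) atTop (𝓝 V) := by
    have t1 := tendsto_sum_weight_mul_weight hh (s₁ := s₁) (s₂ := s₁) (by linarith) h₁₁
    have t2 := tendsto_sum_weight_mul_weight hh (s₁ := s₁) (s₂ := s₂) (by linarith) h₁₂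
    have t3 := tendsto_sum_weight_mul_weight hh (s₁ := s₂) (s₂ := s₂) (by linarith) h₂₂
    rw [hV]
    refine ((t1.sub (t2.const_mul (2 * r))).add (t3.const_mul (r ^ 2))).congr fun n => ?_
    simp only [hsq, Finset.sum_add_distrib, Finset.sum_sub_distrib, ← Finset.mul_sum]
  -- The factor 4 comes from (u + v)³ ≤ 4(u³ + v³); stepsize constants in [0, 1] keep the weights
  -- nonnegative.
  have hcube : ∀ n k, ∫ ω, |ξ n k ω| ^ 3 ∂P ≤
      4 * C * (√(n * h n) ^ 3 * (weight s₁ (k + 1) n ^ 3 * (h (k + 1) ^ 2)⁻¹))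
      + 4 * |r| ^ 3 * C * (√(n * h n) ^ 3 * (weight s₂ (k + 1) n ^ 3 * (h (k + 1) ^ 2)⁻¹)) := by
    intro n k
    have hk : 1 ≤ k + 1 := by omega
    have hw1 := weight_nonneg (by linarith : 0 ≤ s₁) hs₁' (k + 1) n
    have hw2 := weight_nonneg (by linarith : 0 ≤ s₂) hs₂' (k + 1) n
    have hhk := hh.1 (k + 1) hk
    have iz := integrable_abs_pow_three (hZ (k + 1) hk)
    have iw := integrable_abs_pow_three (hW (k + 1) hk)
    have hbd : ∀ ω, |ξ n k ω| ^ 3 ≤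
        4 * √(n * h n) ^ 3 * weight s₁ (k + 1) n ^ 3 * |Z (k + 1) ω| ^ 3
        + 4 * |r| ^ 3 * √(n * h n) ^ 3 * weight s₂ (k + 1) n ^ 3 * |W (k + 1) ω| ^ 3 := by
      intro ω
      simp only [hξ]
      rw [abs_mul, mul_pow, abs_of_nonneg (Real.sqrt_nonneg _)]
      have e1 : |weight s₁ (k + 1) n * Z (k + 1) ω - r * (weight s₂ (k + 1) n * W (k + 1) ω)|
          ≤ weight s₁ (k + 1) n * |Z (k + 1) ω| + |r| * (weight s₂ (k + 1) n * |W (k + 1) ω|) := by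
        refine (abs_sub _ _).trans_eq ?_
        rw [abs_mul, abs_mul, abs_mul, abs_of_nonneg hw1, abs_of_nonneg hw2]
      have e2 := pow_le_pow_left₀ (abs_nonneg _) e1 3
      have e3 := add_pow_le (mul_nonneg hw1 (abs_nonneg (Z (k + 1) ω)))
        (mul_nonneg (abs_nonneg r) (mul_nonneg hw2 (abs_nonneg (W (k + 1) ω)))) 3
      have e4 := mul_le_mul_of_nonneg_left (e2.trans e3)
        (pow_nonneg (Real.sqrt_nonneg (n * h n)) 3)
      refine e4.trans_eq ?_
      norm_num
      ring
    have hstep : ∫ ω, |ξ n k ω| ^ 3 ∂P ≤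
        4 * √(n * h n) ^ 3 * weight s₁ (k + 1) n ^ 3 * ∫ ω, |Z (k + 1) ω| ^ 3 ∂P
        + 4 * |r| ^ 3 * √(n * h n) ^ 3 * weight s₂ (k + 1) n ^ 3
          * ∫ ω, |W (k + 1) ω| ^ 3 ∂P := by
      refine (integral_mono (integrable_abs_pow_three (hL n k))
        ((iz.const_mul _).add (iw.const_mul _)) hbd).trans_eq ?_
      rw [integral_add' (iz.const_mul _) (iw.const_mul _), integral_const_mul, integral_const_mul]
    have hz' : ∫ ω, |Z (k + 1) ω| ^ 3 ∂P ≤ C * (h (k + 1) ^ 2)⁻¹ := by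
      rw [← div_eq_mul_inv, le_div_iff₀ (by positivity), mul_comm]
      exact hZ3 _ hk
    have hw' : ∫ ω, |W (k + 1) ω| ^ 3 ∂P ≤ C * (h (k + 1) ^ 2)⁻¹ := by
      rw [← div_eq_mul_inv, le_div_iff₀ (by positivity), mul_comm]
      exact hW3 _ hk
    refine hstep.trans ((add_le_add (mul_le_mul_of_nonneg_left hz' (by positivity))
      (mul_le_mul_of_nonneg_left hw' (by positivity))).trans_eq ?_)
    ring
  have hlim3 : Tendsto (fun n => ∑ k ∈ Finset.range n, ∫ ω, |ξ n k ω| ^ 3 ∂P) atTop (𝓝 0) := by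
    have t1 := (tendsto_sum_weight_pow hh ha hs₁).const_mul (4 * C)
    have t2 := (tendsto_sum_weight_pow hh ha hs₂).const_mul (4 * |r| ^ 3 * C)
    have t3 := t1.add t2
    rw [mul_zero, mul_zero, add_zero] at t3
    refine squeeze_zero (fun n => Finset.sum_nonneg fun k _ => integral_nonneg fun ω => by
      positivity) (fun n => (Finset.sum_le_sum fun k _ => hcube n k).trans_eq ?_) t3
    simp only [Finset.sum_add_distrib, ← Finset.mul_sum]
  refine ⟨ge_of_tendsto' hlimV fun n => Finset.sum_nonneg fun k _ =>
    integral_nonneg fun ω => sq_nonneg _, ?_⟩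
  rw [hsum]
  exact tendstoInDistribution_of_lyapunov hindξ hL h0 hlimV hlim3

include hh ha hind hW hW0 h₂₂ hs₂ in
/-- Consistency of a recursion driven by centred variables. -/
theorem tendstoInMeasure_recursion :
    TendstoInMeasure P (fun n ω => recursion (fun k => s₂ / (k : ℝ)) (fun k => W k ω) n) atTop
      (fun _ => 0) := by
  have hW2 : ∀ k, MemLp (W (k + 1)) 2 P := fun k =>
    (hW (k + 1) (by omega)).mono_exponent (q := 3) (p := 2) (by norm_num)
  have hsum : (fun n ω => recursion (fun k => s₂ / (k : ℝ)) (fun k => W k ω) n)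
      = fun n => ∑ k ∈ Finset.range n, fun ω => weight s₂ (k + 1) n * W (k + 1) ω := by
    ext n ω
    rw [recursion_eq_sum, Finset.sum_apply]
  have hmem : ∀ n k, MemLp (fun ω => weight s₂ (k + 1) n * W (k + 1) ω) 2 P := fun n k =>
    (hW2 k).const_mul _
  rw [hsum]
  refine tendstoInMeasure_of_variance (fun n => memLp_finsetSum' _ fun k _ => hmem n k)
    (fun n => ?_) ?_
  · simp only [Finset.sum_apply]
    rw [integral_finsetSum _ fun k _ => (hmem n k).integrable (by norm_num)]
    refine Finset.sum_eq_zero fun k _ => ?_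
    rw [integral_const_mul, hW0 _ (by omega), mul_zero]
  · have hvar : ∀ n, Var[∑ k ∈ Finset.range n, fun ω => weight s₂ (k + 1) n * W (k + 1) ω; P]
        = ∑ k ∈ Finset.range n, weight s₂ (k + 1) n * weight s₂ (k + 1) n
          * ∫ ω, W (k + 1) ω * W (k + 1) ω ∂P := by
      intro n
      have hindW : iIndepFun (fun k ω => weight s₂ (k + 1) n * W (k + 1) ω) P :=
        hind.comp (fun k p => weight s₂ (k + 1) n * p.2) fun k => by fun_prop
      rw [IndepFun.variance_sum (fun k _ => hmem n k) fun i _ j _ hij => hindW.indepFun hij]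
      refine Finset.sum_congr rfl fun k _ => ?_
      rw [variance_const_mul, variance_of_integral_eq_zero
        (hW2 k).aestronglyMeasurable.aemeasurable (hW0 _ (by omega))]
      simp only [sq]
    simp only [hvar]
    have t1 := tendsto_sum_weight_mul_weight hh (s₁ := s₂) (s₂ := s₂) (by linarith) h₂₂
    -- The variance times n h_n converges and n h_n → ∞, so the variance vanishes.
    have t2 := (tendsto_inv_of_ratioRate (natCast_mul_pos hh) (ratioRate_natCast_mul hh)
      (by linarith)).mul t1
    rw [zero_mul] at t2
    refine t2.congr' ?_
    filter_upwards [eventually_ge_atTop 1] with n hn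
    rw [inv_mul_cancel_left₀ (natCast_mul_pos hh n hn).ne']

end Core

section Slutsky

variable {Ω Ω' : Type*} [MeasurableSpace Ω] {P : Measure Ω} [IsProbabilityMeasure P]
  [MeasurableSpace Ω'] {P' : Measure Ω'} [IsProbabilityMeasure P']

/-! ### Ratios and affine changes of the limit -/

theorem tendstoInDistribution_id_of_map_eq {U : ℕ → Ω → ℝ} {Z : Ω' → ℝ} {ν : Measure ℝ}
    [IsProbabilityMeasure ν] (hU : TendstoInDistribution U atTop Z (fun _ => P) P')
    (hν : P'.map Z = ν) : TendstoInDistribution U atTop (id : ℝ → ℝ) (fun _ => P) ν where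
  forall_aemeasurable := hU.forall_aemeasurable
  tendsto := by
    subst hν
    simpa only [Measure.map_id] using hU.tendsto

omit [IsProbabilityMeasure P] in
/-- A deterministic convergent sequence added to a sequence vanishing in probability. -/
theorem tendstoInMeasure_add_const {S : ℕ → Ω → ℝ} {u : ℕ → ℝ} {f : ℝ}
    (hS : TendstoInMeasure P S atTop (fun _ => 0)) (hu : Tendsto u atTop (𝓝 f)) :
    TendstoInMeasure P (fun n ω => S n ω + u n) atTop (fun _ => f) := by
  rw [tendstoInMeasure_iff_norm] at hS ⊢
  intro ε hε
  refine tendsto_of_tendsto_of_tendsto_of_le_of_le' tendsto_const_nhds (hS (ε / 2) (half_pos hε))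
    (Eventually.of_forall fun n => zero_le) ?_
  filter_upwards [Metric.tendsto_nhds.1 hu (ε / 2) (half_pos hε)] with n hn
  refine measure_mono fun ω hω => ?_
  simp only [Set.mem_ofPred_eq, sub_zero, Real.norm_eq_abs] at hω ⊢
  rw [Real.dist_eq] at hn
  have := abs_add_le (S n ω) (u n - f)
  rw [← add_sub_assoc] at this
  linarith

/-- Slutsky's theorem for a normalised ratio `A / F` centred at `r`, set to `0` where `F` vanishes. -/
theorem tendstoInDistribution_ratio {A F : ℕ → Ω → ℝ} {m : ℕ → ℝ} {r f : ℝ} {Z : Ω' → ℝ}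
    (hf : 0 < f) (hAm : ∀ n, AEMeasurable (A n) P) (hFm : ∀ n, AEMeasurable (F n) P)
    (hU : TendstoInDistribution (fun n ω => m n * (A n ω - r * F n ω)) atTop Z (fun _ => P) P')
    (hF : TendstoInMeasure P F atTop (fun _ => f)) :
    TendstoInDistribution (fun n ω => m n * ((if F n ω ≠ 0 then A n ω / F n ω else 0) - r)) atTop
      (fun z => Z z * f⁻¹) (fun _ => P) P' := by
  -- Division by zero yields 0, in agreement with the convention for the estimator.
  have hdiv : ∀ n ω, (if F n ω ≠ 0 then A n ω / F n ω else 0) = A n ω / F n ω := fun n ω => by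
    split_ifs with h0
    · rfl
    · rw [not_not.1 h0, div_zero]
  simp only [hdiv]
  -- Truncating the denominator below at f/2 makes the map continuous everywhere. The truncated
  -- ratio differs from the true one only where |F - f| ≥ f/2, an event of vanishing probability.
  have hg : Continuous fun p : ℝ × ℝ => p.1 * (max p.2 (f / 2))⁻¹ :=
    continuous_fst.mul ((continuous_snd.max continuous_const).inv₀ fun p =>
      (lt_of_lt_of_le (half_pos hf) (le_max_right _ _)).ne')
  have h1 := hU.continuous_comp_prodMk_of_tendstoInMeasure_const hg hF hFm
  simp only [max_eq_left (half_le_self hf.le)] at h1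
  refine tendstoInDistribution_of_tendstoInMeasure_sub _ _ h1 ?_ fun n =>
    (((hAm n).div (hFm n)).sub_const r).const_mul _
  rw [tendstoInMeasure_iff_norm] at hF ⊢
  intro ε hε
  refine tendsto_of_tendsto_of_tendsto_of_le_of_le tendsto_const_nhds (hF (f / 2) (half_pos hf))
    (fun n => zero_le) fun n => measure_mono fun ω hω => ?_
  by_contra hlt
  simp only [Set.mem_ofPred_eq, not_le, Real.norm_eq_abs] at hlt
  have h2 : f / 2 < F n ω := by
    have := (abs_lt.1 hlt).1
    linarith
  have h3 : F n ω ≠ 0 := by linarith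
  have h4 : m n * (A n ω / F n ω - r) - m n * (A n ω - r * F n ω) * (max (F n ω) (f / 2))⁻¹ = 0 := by
    rw [max_eq_left h2.le]
    field_simp
    ring
  simp only [Set.mem_ofPred_eq, Pi.sub_apply, Pi.zero_apply, sub_zero] at hω
  rw [h4, norm_zero] at hω
  linarith

end Slutsky

/-! ### The kernel observations -/

variable {Ω : Type*} [MeasurableSpace Ω] {P : Measure Ω} [IsProbabilityMeasure P]
  {X Y : ℕ → Ω → ℝ} {g : ℝ → ℝ → ℝ} {K : ℝ → ℝ} {h : ℕ → ℝ} {a x c : ℝ}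

/-- The `k`-th observation `h_k⁻¹ K((x - X_k) / h_k) Y_k ^ q`. -/
noncomputable def kernelObs (h : ℕ → ℝ) (K : ℝ → ℝ) (X Y : ℕ → Ω → ℝ) (x : ℝ) (q k : ℕ) (ω : Ω) : ℝ :=
  (h k)⁻¹ * K ((x - X k ω) / h k) * Y k ω ^ q

/-- The mean of the `k`-th observation. -/
noncomputable def kernelMean (g : ℝ → ℝ → ℝ) (h : ℕ → ℝ) (K : ℝ → ℝ) (x : ℝ) (q k : ℕ) : ℝ :=
  ∫ z, K z * moment g q (x - h k * z)

section Observations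

variable (hXY : IsIIDSample P X Y g) (hK : KernelAssumption K) (hh : GS (-a) h)
  (hg : DensityAssumption g x)

include hXY hK hg hh

omit [IsProbabilityMeasure P] in
theorem integral_kernelObs {q k : ℕ} (hq : q ≤ 3) (hk : 1 ≤ k) :
    ∫ ω, kernelObs h K X Y x q k ω ∂P = kernelMean g h K x q k :=
  hXY.integral_kernel hg hK.continuous hK.integrable hq hk (hh.1 k hk)

-- The cube equals h⁻² times an observation with kernel |K|³ and response power 3q, up to absolute
-- values; hence the moment of order 3.
omit [IsProbabilityMeasure P] in
theorem integrable_kernelObs_pow_three {q k : ℕ} (hq : q ≤ 1) (hk : 1 ≤ k) :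
    Integrable (fun ω => |kernelObs h K X Y x q k ω| ^ 3) P := by
  have hhk := hh.1 k hk
  have := ((hXY.integrable_kernel hg (L := fun z => |K z| ^ 3) (hK.continuous.abs.pow 3) hK.integrable_pow_three
    (q := 3 * q) (by omega) hk hhk).abs).const_mul ((h k ^ 2)⁻¹)
  refine this.congr (Eventually.of_forall fun ω => ?_)
  simp only [kernelObs, abs_mul, abs_pow, abs_abs, abs_inv, abs_of_pos hhk]
  rw [pow_mul', mul_pow, mul_pow]
  field_simp

omit [IsProbabilityMeasure P] in
theorem exists_kernelObs_pow_three_le {q : ℕ} (hq : q ≤ 1) :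
    ∃ C, ∀ k, 1 ≤ k → h k ^ 2 * ∫ ω, |kernelObs h K X Y x q k ω| ^ 3 ∂P ≤ C := by
  obtain ⟨C, -, hC⟩ := hXY.exists_integral_abs_kernel_le hg (L := fun z => |K z| ^ 3) (hK.continuous.abs.pow 3)
    hK.integrable_pow_three (q := 3 * q) (by omega)
  refine ⟨C, fun k hk => ?_⟩
  have hhk := hh.1 k hk
  refine (le_of_eq ?_).trans (hC k hk (h k) hhk)
  rw [← integral_const_mul]
  refine integral_congr_ae (Eventually.of_forall fun ω => ?_)
  simp only [kernelObs, abs_mul, abs_pow, abs_abs, abs_inv, abs_of_pos hhk]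
  rw [pow_mul' _ 3 q, mul_pow, mul_pow]
  field_simp

omit [IsProbabilityMeasure P] in
theorem memLp_kernelObs {q k : ℕ} (hq : q ≤ 1) (hk : 1 ≤ k) :
    MemLp (kernelObs h K X Y x q k) 3 P := by
  have hi := hXY.integrable_kernel hg hK.continuous hK.integrable (q := q) (by omega) hk (hh.1 k hk)
  refine (integrable_norm_rpow_iff hi.aestronglyMeasurable (by norm_num) (by norm_num)).1 ?_
  refine (integrable_kernelObs_pow_three hXY hK hh hg hq hk).congr
    (Eventually.of_forall fun ω => ?_)
  simp only [Real.norm_eq_abs, ENNReal.toReal_ofNat]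
  exact (Real.rpow_natCast _ 3).symm

theorem memLp_centered {q k : ℕ} (hq : q ≤ 1) (hk : 1 ≤ k) :
    MemLp (fun ω => kernelObs h K X Y x q k ω - kernelMean g h K x q k) 3 P :=
  (memLp_kernelObs hXY hK hh hg hq hk).sub (memLp_const _)

theorem integral_centered {q k : ℕ} (hq : q ≤ 1) (hk : 1 ≤ k) :
    ∫ ω, (kernelObs h K X Y x q k ω - kernelMean g h K x q k) ∂P = 0 := by
  rw [integral_sub ((memLp_kernelObs hXY hK hh hg hq hk).integrable (by norm_num))
    (integrable_const _), integral_kernelObs hXY hK hh hg (by omega) hk]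
  simp

omit hh [IsProbabilityMeasure P] in
theorem tendsto_kernelMean {q : ℕ} (hq : q ≤ 2) (hh0 : Tendsto h atTop (𝓝 0)) :
    Tendsto (fun k => kernelMean g h K x q k) atTop (𝓝 (moment g q x)) := by
  obtain ⟨C, hC⟩ := hg.bounded_moment q hq
  have := tendsto_integral_smoothing hK.integrable (hXY.measurable_moment q) hC
    (hg.continuous_moment q hq) hh0
  rwa [hK.integral_eq_one, mul_one] at this

/-- The scaled mixed second moment is a smoothing of the moment of order p + q by K²; the product of
the means stays bounded and is killed by h_k → 0. -/
theorem tendsto_covariance {p q : ℕ} (hp : p ≤ 1) (hq : q ≤ 1) (hh0 : Tendsto h atTop (𝓝 0)) :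
    Tendsto (fun k => h k * ∫ ω, (kernelObs h K X Y x p k ω - kernelMean g h K x p k)
        * (kernelObs h K X Y x q k ω - kernelMean g h K x q k) ∂P) atTop
      (𝓝 (moment g (p + q) x * kernelR K)) := by
  obtain ⟨C, hC⟩ := hg.bounded_moment (p + q) (by omega)
  have h1 := tendsto_integral_smoothing hK.integrable_sq (hXY.measurable_moment (p + q)) hC
    (hg.continuous_moment (p + q) (by omega)) hh0
  have h2 := (hh0.mul (tendsto_kernelMean hXY hK hg (q := p) (by omega) hh0)).mul
    (tendsto_kernelMean hXY hK hg (q := q) (by omega) hh0)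
  rw [zero_mul, zero_mul] at h2
  have h3 := h1.sub h2
  rw [sub_zero] at h3
  refine h3.congr' ?_
  filter_upwards [eventually_ge_atTop 1] with k hk
  have hhk := hh.1 k hk
  have mp := (memLp_kernelObs hXY hK hh hg hp hk).mono_exponent (q := 3) (p := 2) (by norm_num)
  have mq := (memLp_kernelObs hXY hK hh hg hq hk).mono_exponent (q := 3) (p := 2) (by norm_num)
  have e := covariance_eq_sub mp mq
  rw [covariance, integral_kernelObs hXY hK hh hg (by omega) hk,
    integral_kernelObs hXY hK hh hg (by omega) hk] at e
  rw [e, mul_sub, mul_assoc]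
  congr 1
  rw [← hXY.integral_kernel hg (L := fun z => K z ^ 2) (hK.continuous.pow 2) hK.integrable_sq (by omega) hk hhk,
    ← integral_const_mul]
  refine integral_congr_ae (Eventually.of_forall fun ω => ?_)
  simp only [Pi.mul_apply, kernelObs]
  rw [pow_add]
  field_simp

theorem exists_centered_pow_three_le {q : ℕ} (hq : q ≤ 1) (hh0 : Tendsto h atTop (𝓝 0)) :
    ∃ C, ∀ k, 1 ≤ k →
      h k ^ 2 * ∫ ω, |kernelObs h K X Y x q k ω - kernelMean g h K x q k| ^ 3 ∂P ≤ C := by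
  obtain ⟨C, hC⟩ := exists_kernelObs_pow_three_le hXY hK hh hg hq
  have hlim := (hh0.pow 2).mul ((tendsto_kernelMean hXY hK hg (q := q) (by omega) hh0).abs.pow 3)
  obtain ⟨D, hD⟩ := hlim.bddAbove_range
  refine ⟨4 * (C + D), fun k hk => ?_⟩
  have h1 := integrable_kernelObs_pow_three hXY hK hh hg hq hk
  have h2 : ∫ ω, |kernelObs h K X Y x q k ω - kernelMean g h K x q k| ^ 3 ∂P
      ≤ 4 * (∫ ω, |kernelObs h K X Y x q k ω| ^ 3 ∂P + |kernelMean g h K x q k| ^ 3) := by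
    refine (integral_mono (integrable_abs_pow_three (memLp_centered hXY hK hh hg hq hk))
      ((h1.add (integrable_const _)).const_mul 4) fun ω => ?_).trans_eq
      (b := ∫ ω, 4 * (|kernelObs h K X Y x q k ω| ^ 3 + |kernelMean g h K x q k| ^ 3) ∂P) ?_
    · refine (pow_le_pow_left₀ (abs_nonneg _) (abs_sub _ _) 3).trans
        ((add_pow_le (abs_nonneg _) (abs_nonneg _) 3).trans_eq ?_)
      simp only [Pi.add_apply]
      norm_num
    · rw [integral_const_mul, integral_add h1 (integrable_const _)]
      simp
  have h3 : h k ^ 2 * |kernelMean g h K x q k| ^ 3 ≤ D := hD ⟨k, rfl⟩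
  have h4 := mul_le_mul_of_nonneg_left h2 (sq_nonneg (h k))
  have := hC k hk
  linarith

omit [IsProbabilityMeasure P] in
/-- The normalised bias of the observations. -/
theorem tendsto_kernelMean_sub {q : ℕ} (hq : q ≤ 2) (hm : TwiceDifferentiableAt (moment g q) x)
    (hnc : Tendsto (fun n : ℕ => (n : ℝ) * h n ^ 5) atTop (𝓝 c)) :
    Tendsto (fun n : ℕ => √(n * h n) * (kernelMean g h K x q n - moment g q x)) atTop
      (𝓝 (√c * (iteratedDeriv 2 (moment g q) x / 2 * kernelMoment 2 K))) := by
  obtain ⟨C, hC⟩ := hg.bounded_moment q hq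
  have hpos : ∀ᶠ n in atTop, 0 < h n := (eventually_ge_atTop 1).mono hh.1
  have h1 := hK.tendsto_bias (hXY.measurable_moment q) hC hm (tendsto_bandwidth hh c hnc)
    (hpos.mono fun n hn => hn.ne')
  refine (hnc.sqrt.mul h1).congr' ?_
  filter_upwards [hpos] with n hn
  -- Here the bias order h_n² meets the normalisation √(n h_n) and produces √c.
  have h2 : √((n : ℝ) * h n ^ 5) = √(n * h n) * h n ^ 2 := by
    rw [show (n : ℝ) * h n ^ 5 = (n * h n) * (h n ^ 2) ^ 2 by ring,
      Real.sqrt_mul' _ (sq_nonneg _), Real.sqrt_sq (sq_nonneg _)]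
  rw [h2, kernelMean]
  field_simp

omit [IsProbabilityMeasure P] hK hg hh in
theorem iIndepFun_centered (hKc : Continuous K) : iIndepFun (fun (k : ℕ) ω =>
    (kernelObs h K X Y x 1 (k + 1) ω - kernelMean g h K x 1 (k + 1),
      kernelObs h K X Y x 0 (k + 1) ω - kernelMean g h K x 0 (k + 1))) P := by
  have hm := hKc.measurable
  exact hXY.indep.comp (fun k p =>
    ((h (k + 1))⁻¹ * K ((x - p.1) / h (k + 1)) * p.2 ^ 1 - kernelMean g h K x 1 (k + 1),
      (h (k + 1))⁻¹ * K ((x - p.1) / h (k + 1)) * p.2 ^ 0 - kernelMean g h K x 0 (k + 1)))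
    fun k => by fun_prop

end Observations

/-! ### Asymptotic normality of the ratio estimator. -/

theorem recursion_sub (s w v : ℕ → ℝ) (n : ℕ) :
    recursion s (fun k => w k - v k) n = recursion s w n - recursion s v n := by
  induction n with
  | zero => simp [recursion]
  | succ n ih =>
    simp only [recursion, ih]
    ring

/-- Asymptotic normality of the semi-recursive estimator for stepsizes `s₂ / n` and `s₁ / n`
with `s₁, s₂ ∈ [1 - a, 1]`. -/
theorem tendstoGaussian_rEst (hXY : IsIIDSample P X Y g) (hK : KernelAssumption K) (ha1 : a < 1)
    (hh : GS (-a) h) (hg : DensityAssumption g x) (hfx : 0 < density g x)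
    (hf2 : TwiceDifferentiableAt (density g) x) (ha2 : TwiceDifferentiableAt (regNumerator g) x)
    (hnc : Tendsto (fun n : ℕ => (n : ℝ) * h n ^ 5) atTop (𝓝 c)) {s₁ s₂ : ℝ} (hs₁ : 1 - a ≤ s₁)
    (hs₁' : s₁ ≤ 1) (hs₂ : 1 - a ≤ s₂) (hs₂' : s₂ ≤ 1) {b V : ℝ}
    (hb : b = (s₁ * (√c * (iteratedDeriv 2 (regNumerator g) x / 2 * kernelMoment 2 K))
        / (s₁ - (1 - a) / 2)
      - regression g x * (s₂ * (√c * (iteratedDeriv 2 (density g) x / 2 * kernelMoment 2 K))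
        / (s₂ - (1 - a) / 2))) / density g x)
    (hV : V = (s₁ * s₁ * (moment g 2 x * kernelR K) / (s₁ + s₁ - (1 - a))
      - 2 * regression g x * (s₁ * s₂ * (regNumerator g x * kernelR K) / (s₁ + s₂ - (1 - a)))
      + regression g x ^ 2 * (s₂ * s₂ * (density g x * kernelR K) / (s₂ + s₂ - (1 - a))))
        / density g x ^ 2) :
    TendstoGaussian P (fun n ω => √((n : ℝ) * h n) *
      (rEst (fun k => s₂ / (k : ℝ)) (fun k => s₁ / (k : ℝ)) h K X Y x n ω - regression g x)) b V := by
  set r := regression g x with hr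
  set f := density g x with hf
  have hh0 := tendsto_bandwidth hh c hnc
  set A : ℕ → Ω → ℝ := fun n ω => recursion (fun k => s₁ / (k : ℝ))
    (fun k => kernelObs h K X Y x 1 k ω) n with hA
  set F : ℕ → Ω → ℝ := fun n ω => recursion (fun k => s₂ / (k : ℝ))
    (fun k => kernelObs h K X Y x 0 k ω) n with hF
  have hrEst : ∀ n ω, rEst (fun k => s₂ / (k : ℝ)) (fun k => s₁ / (k : ℝ)) h K X Y x n ω
      = if F n ω ≠ 0 then A n ω / F n ω else 0 := by
    intro n ω
    have e1 : A n ω = aEst (fun k => s₁ / (k : ℝ)) h K X Y x n ω := by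
      simp only [hA, aEst, kernelObs, pow_one, mul_right_comm]
    have e2 : F n ω = fEst (fun k => s₂ / (k : ℝ)) h K X x n ω := by
      simp only [hF, fEst, kernelObs, pow_zero, mul_one]
    rw [rEst, e1, e2]
  have hmeas : ∀ (s : ℝ) (q : ℕ), q ≤ 1 → ∀ n, AEMeasurable (fun ω => recursion
      (fun k => s / (k : ℝ)) (fun k => kernelObs h K X Y x q k ω) n) P := by
    intro s q hq n
    simp only [recursion_eq_sum]
    exact Finset.aemeasurable_fun_sum _ fun k _ =>
      ((memLp_kernelObs hXY hK hh hg hq (by omega)).aestronglyMeasurable.aemeasurable).const_mul _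
  obtain ⟨C₁, hC₁⟩ := exists_centered_pow_three_le hXY hK hh hg (q := 1) le_rfl hh0
  obtain ⟨C₀, hC₀⟩ := exists_centered_pow_three_le hXY hK hh hg (q := 0) zero_le_one hh0
  have c11 := tendsto_covariance hXY hK hh hg (p := 1) (q := 1) le_rfl le_rfl hh0
  have c10 := tendsto_covariance hXY hK hh hg (p := 1) (q := 0) le_rfl zero_le_one hh0
  have c00 := tendsto_covariance hXY hK hh hg (p := 0) (q := 0) zero_le_one zero_le_one hh0
  have hind := iIndepFun_centered (h := h) (x := x) hXY hK.continuous
  -- V f² is the limiting variance of the linear statistic, before division by the density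
  -- estimator.
  have hV' : V * f ^ 2 = s₁ * s₁ * (moment g (1 + 1) x * kernelR K) / (s₁ + s₁ - (1 - a))
      - 2 * r * (s₁ * s₂ * (moment g (1 + 0) x * kernelR K) / (s₁ + s₂ - (1 - a)))
      + r ^ 2 * (s₂ * s₂ * (moment g (0 + 0) x * kernelR K) / (s₂ + s₂ - (1 - a))) := by
    rw [hV, div_mul_cancel₀ _ (pow_ne_zero 2 hfx.ne'),
      show moment g (0 + 0) x = f from congrFun (moment_zero g) x]
    rfl
  obtain ⟨hV0, hclt⟩ := tendstoInDistribution_recursion hh ha1 hind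
    (fun k hk => memLp_centered hXY hK hh hg le_rfl hk)
    (fun k hk => memLp_centered hXY hK hh hg zero_le_one hk)
    (fun k hk => integral_centered hXY hK hh hg le_rfl hk)
    (fun k hk => integral_centered hXY hK hh hg zero_le_one hk) c11 c10 c00
    (fun k hk => (hC₁ k hk).trans (le_max_left C₁ C₀))
    (fun k hk => (hC₀ k hk).trans (le_max_right C₁ C₀)) hs₁ hs₁' hs₂ hs₂' r hV'
  have hcons := tendstoInMeasure_recursion hh ha1
    (Z := fun k ω => kernelObs h K X Y x 1 k ω - kernelMean g h K x 1 k)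
    (W := fun k ω => kernelObs h K X Y x 0 k ω - kernelMean g h K x 0 k) hind
    (fun k hk => memLp_centered hXY hK hh hg zero_le_one hk)
    (fun k hk => integral_centered hXY hK hh hg zero_le_one hk) c00 hs₂
  simp only [recursion_sub] at hclt hcons
  set mA : ℕ → ℝ := recursion (fun k => s₁ / (k : ℝ)) (kernelMean g h K x 1) with hmA
  set mF : ℕ → ℝ := recursion (fun k => s₂ / (k : ℝ)) (kernelMean g h K x 0) with hmF
  have hbA := tendsto_recursion_sub hh ha1 hs₁
    (tendsto_kernelMean_sub hXY hK hh hg (q := 1) (by norm_num) ha2 hnc)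
  have hbF := tendsto_recursion_sub hh ha1 hs₂
    (tendsto_kernelMean_sub hXY hK hh hg (q := 0) (by norm_num) (by rwa [moment_zero]) hnc)
  rw [moment_zero] at hbF
  have hra : moment g 1 x = r * f := by
    rw [hr, hf, regression, condMoment, div_mul_cancel₀ _ hfx.ne']
  -- Since a(x) = r f(x), the centring constants cancel in mA - r mF and the two bias limits combine
  -- linearly.
  have hbias : Tendsto (fun n : ℕ => √(n * h n) * (mA n - r * mF n)) atTop (𝓝 (b * f)) := by
    rw [hb, div_mul_cancel₀ _ hfx.ne']
    refine (hbA.sub (hbF.const_mul r)).congr fun n => ?_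
    rw [hra]
    ring
  have hFlim : TendstoInMeasure P F atTop (fun _ => f) := by
    have hmFlim : Tendsto mF atTop (𝓝 f) := by
      have e1 := (tendsto_inv_of_ratioRate (fun n hn => Real.sqrt_pos.2 (natCast_mul_pos hh n hn))
        (ratioRate_sqrt hh) (by linarith)).mul hbF
      rw [zero_mul] at e1
      refine tendsto_sub_nhds_zero_iff.1 (e1.congr' ?_)
      filter_upwards [eventually_ge_atTop 1] with n hn
      rw [inv_mul_cancel_left₀ (Real.sqrt_pos.2 (natCast_mul_pos hh n hn)).ne']
    refine (tendstoInMeasure_add_const hcons hmFlim).congr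
      (fun n => Eventually.of_forall fun ω => ?_) (Eventually.of_forall fun ω => rfl)
    simp only [hF, sub_add_cancel]
  have hU : TendstoInDistribution (fun (n : ℕ) ω => √(n * h n) * (A n ω - r * F n ω)) atTop
      (fun z : ℝ => id z + b * f) (fun _ => P) (gaussianReal 0 (V * f ^ 2).toNNReal) := by
    have e2 : TendstoInMeasure P (fun (n : ℕ) (_ : Ω) => √(n * h n) * (mA n - r * mF n)) atTop
        (fun _ => b * f) :=
      tendstoInMeasure_of_tendsto_ae (fun n => aestronglyMeasurable_const)
        (Eventually.of_forall fun _ => hbias)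
    have e3 := hclt.add_of_tendstoInMeasure_const e2 fun n => aemeasurable_const
    refine e3.congr (fun n => Eventually.of_forall fun ω => ?_) (Eventually.of_forall fun z => rfl)
    simp only [Pi.add_apply, hA, hF, hmA, hmF]
    ring
  have hfin := tendstoInDistribution_ratio hfx (hmeas s₁ 1 le_rfl) (hmeas s₂ 0 zero_le_one) hU hFlim
  refine ⟨nonneg_of_mul_nonneg_left hV0 (by positivity), ?_⟩
  · simp only [hrEst]
    refine tendstoInDistribution_id_of_map_eq hfin ?_
    have e1 : (fun z : ℝ => (id z + b * f) * f⁻¹) = (fun z => z * f⁻¹) ∘ fun z => z + b * f := rfl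
    rw [e1, ← Measure.map_map (by fun_prop) (by fun_prop), gaussianReal_map_add_const,
      gaussianReal_map_mul_const]
    congr 1
    · field_simp
      ring
    · ext
      rw [NNReal.coe_mul, Real.coe_toNNReal _ hV0,
        Real.coe_toNNReal _ (nonneg_of_mul_nonneg_left hV0 (by positivity))]
      simp only [NNReal.coe_mk]
      field_simp

end SemiRecursive

/-! ### Evaluation of the constants for the two stepsize choices. -/

theorem corollary4 {Ω : Type*} [MeasurableSpace Ω] (P : Measure Ω) [IsProbabilityMeasure P]
    (X Y : ℕ → Ω → ℝ) (g : ℝ → ℝ → ℝ) (K : ℝ → ℝ) (h : ℕ → ℝ) (a x c : ℝ)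
    (hXY : SemiRecursive.IsIIDSample P X Y g)
    (hK : SemiRecursive.KernelAssumption K)
    (ha0 : 0 < a) (ha1 : a < 1) (hh : SemiRecursive.GS (-a) h)
    (hg : SemiRecursive.DensityAssumption g x)
    (hfx : 0 < SemiRecursive.density g x)
    (hf2 : SemiRecursive.TwiceDifferentiableAt (SemiRecursive.density g) x)
    (ha2 : SemiRecursive.TwiceDifferentiableAt (SemiRecursive.regNumerator g) x)
    (hc : 0 ≤ c) (hnc : Tendsto (fun n : ℕ => (n : ℝ) * h n ^ 5) atTop (𝓝 c)) :
    SemiRecursive.TendstoGaussian P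
        (fun n ω => √((n : ℝ) * h n) *
          (SemiRecursive.rEst (fun k => (1 - a) / (k : ℝ)) (fun k => 1 / (k : ℝ)) h K X Y x n ω
            - SemiRecursive.regression g x))
        (√c * SemiRecursive.biasConst K g x a 1)
        (SemiRecursive.varConst K g x a 1 1) ∧
      SemiRecursive.TendstoGaussian P
        (fun n ω => √((n : ℝ) * h n) *
          (SemiRecursive.rEst (fun k => (1 - a) / (k : ℝ)) (fun k => (1 - a) / (k : ℝ)) h K X Y x n ω
            - SemiRecursive.regression g x))
        (√c * SemiRecursive.biasConst K g x a (1 - a)⁻¹)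
        ((1 - a) * SemiRecursive.varConst K g x a (1 - a)⁻¹ 1) := by
  have hf0 := hfx.ne'
  have h1a : (1 - a) ≠ 0 := by linarith
  have h1a' : 1 + a ≠ 0 := by linarith
  have hreg : SemiRecursive.regNumerator g x
      = SemiRecursive.regression g x * SemiRecursive.density g x := by
    rw [SemiRecursive.regression, SemiRecursive.condMoment, div_mul_cancel₀ _ hf0]
    rfl
  refine ⟨SemiRecursive.tendstoGaussian_rEst hXY hK ha1 hh hg hfx hf2 ha2 hnc (s₁ := 1)
    (s₂ := 1 - a) (by linarith) le_rfl le_rfl (by linarith) ?_ ?_,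
    SemiRecursive.tendstoGaussian_rEst hXY hK ha1 hh hg hfx hf2 ha2 hnc (s₁ := 1 - a)
    (s₂ := 1 - a) le_rfl (by linarith) le_rfl (by linarith) ?_ ?_⟩
  -- If c = 0 both means vanish, whatever the denominators. Otherwise a = 1/5, where (1 - a)/2 = 2a,
  -- so the factor s/(s - (1 - a)/2) from the recursion is the stated s/(s - 2a).
  · rcases hc.eq_or_lt with rfl | hc
    · simp
    · rw [SemiRecursive.eq_one_fifth hh hc hnc, SemiRecursive.biasConst]
      field_simp
      ring
  -- With a(x) = r f(x), the cross term -2(1 - a)r²f and the density term (1 - a)r²f merge into -(1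
  -- - a)r²f, each carrying the factor R(K)/f².
  · rw [hreg, SemiRecursive.varConst, SemiRecursive.condMoment]
    have e1 : (1 : ℝ) + 1 - (1 - a) = 1 + a := by ring
    have e2 : 2 - (1 - a) * 1 = 1 + a := by ring
    have e3 : 1 + (1 - a) - (1 - a) = 1 := by ring
    have e4 : (1 - a) + (1 - a) - (1 - a) = 1 - a := by ring
    rw [e1, e2, e3, e4]
    field_simp
    ring
  · rcases hc.eq_or_lt with rfl | hc
    · simp
    · rw [SemiRecursive.eq_one_fifth hh hc hnc, SemiRecursive.biasConst]
      field_simp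
      ring
  · rw [hreg, SemiRecursive.varConst, SemiRecursive.condMoment]
    have e2 : 2 - (1 - a) * (1 - a)⁻¹ = 1 := by
      rw [mul_inv_cancel₀ h1a]
      norm_num
    have e4 : (1 - a) + (1 - a) - (1 - a) = 1 - a := by ring
    rw [e2, e4]
    field_simp
    ring
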